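/- **Notation.** For a groupoid $X$ let $\pi_0X$ be its set of isomorphism classes. $X$ is *locally finite* if all automorphism groups are finite, and *finite* if moreover $\pi_0X$ is finite; the homotopy cardinality of a finite groupoid is $|X|=\sum_{x\in\pi_0X}1/|\mathrm{Aut}(x)|$. Pullbacks and fibres of groupoids are homotopy pullbacks and homotopy fibres, and a functor is *finite* if all its fibres are finite. For a functor $p\colon Y\to B$ from a finite groupoid to a locally finite one put $|p|=\sum_{b\in\pi_0B}\frac{|Y_b|}{|\mathrm{Aut}(b)|}\,\delta_b\in\mathbb Q_{\pi_0B}$, the $\mathbb Q$-vector space with basis $(\delta_b)_{b\in\pi_0 B}$. Let $\mathbf S$ be the category of finite sets and surjections, and let $X=N\mathbf S$ be its fat nerve: $X_n$ is the groupoid of functors $[n]\to\mathbf S$ and natural isomorphisms. Let $\mathbb S=X_1$, the groupoid of surjections between finite sets. Equip $\mathbb Q_{\pi_0\mathbb S}$ with the product $\delta_a\cdot\delta_b=\delta_{a+b}$, where $+$ is disjoint union, and with the linear maps determined by $$\Delta(\delta_f)=\big|(d_2,d_0)_!\,d_1^*\ulcorner f\urcorner\big|\in\mathbb Q_{\pi_0(\mathbb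 S\times\mathbb S)}\cong\mathbb Q_{\pi_0\mathbb S}\otimes\mathbb Q_{\pi_0\mathbb S},\qquad \epsilon(\delta_f)=\big|s_0^*\ulcorner f\urcorner\big|,$$ where $\ulcorner f\urcorner\colon1\to\mathbb S$ picks out $f$, $d_1^*$ and $s_0^*$ denote pullback along $d_1\colon X_2\to X_1$ and $s_0\colon X_0\to X_1$, and $(d_2,d_0)_!$ is postcomposition with $(d_2,d_0)\colon X_2\to X_1\times X_1$. This is the homotopy cardinality of the incidence bialgebra of $N\mathbf S$. Let $\mathcal F=\mathbb Q[A_1,A_2,\dots]$, where $A_n$ is the functional $A_n(F)=\frac{d^nF}{dx^n}(0)$ on power series, and elements of $\mathcal F$ (respectively $\mathcal F\otimes\mathcal F$) are evaluated at a series $F$ (respectively at $F\otimes G$) multiplicatively. **Theorem.** 1. $N\mathbf S$ is locally finite: $X_1$ is a locally finite groupoid and $s_0\colon X_0\to X_1$ and $d_1\colon X_2\to X_1$ are finite. With the structure above $\mathbb Q_{\pi_0\mathbb S}$ is a bialgebra over $\mathbb Q$. 2. There is exactly one algebra homomorphism $\Delta\colon\mathcal F\to\mathcal F\otimes\mathcal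 F$ that is dual to substitution of power series, i.e. satisfies $\Delta(A_n)(F\otimes G)=A_n(G\circ F)$ for all $n\ge1$ and all $F,G\in\mathbb Q[[x]]$ with $F(0)=0$. With this comultiplication and the counit $\epsilon(A_n)=A_n(x)$, $\mathcal F$ is a bialgebra, the Faà di Bruno bialgebra. 3. There is an isomorphism of bialgebras $\mathcal F\cong\mathbb Q_{\pi_0\mathbb S}$ that sends $A_n$, for every $n\ge1$, to the class $\delta_n$ of the surjection $n\twoheadrightarrow1$. -/

import Mathlib

open CategoryTheory Opposite TensorProduct

/-! ## Groupoids and homotopy cardinality -/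

section Groupoids

universe v₁ v₂ v₃ u₁ u₂ u₃

/-- The set `π₀(X)` of isomorphism classes of objects of `X`. -/
def PiZero (X : Type u₁) [Groupoid.{v₁} X] : Type u₁ := Quotient (isIsomorphicSetoid X)

/-- The isomorphism class of an object. -/
def PiZero.mk {X : Type u₁} [Groupoid.{v₁} X] (x : X) : PiZero X :=
  Quotient.mk (isIsomorphicSetoid X) x

/-- A chosen representative of an isomorphism class. -/
noncomputable def PiZero.rep {X : Type u₁} [Groupoid.{v₁} X] (c : PiZero X) : X :=
  Quotient.out (s := isIsomorphicSetoid X) c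

/-- A groupoid is locally finite if all its automorphism groups are finite. -/
def IsLocallyFiniteGroupoid (X : Type u₁) [Groupoid.{v₁} X] : Prop :=
  ∀ x : X, Finite (Aut x)

/-- A groupoid is finite if it is locally finite and has finitely many isomorphism classes. -/
def IsFiniteGroupoid (X : Type u₁) [Groupoid.{v₁} X] : Prop :=
  Finite (PiZero X) ∧ IsLocallyFiniteGroupoid X

/-- The homotopy cardinality `∑_{x ∈ π₀ X} 1 / |Aut x|` of a (finite) groupoid. -/
noncomputable def homotopyCard (X : Type u₁) [Groupoid.{v₁} X] : ℚ :=
  ∑ᶠ c : PiZero X, 1 / (Nat.card (Aut c.rep) : ℚ)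

/-- The homotopy pullback of `F : X ⥤ B` and `G : Y ⥤ B`: objects are triples `(x, y, φ)` with
`φ : F x ⟶ G y`, morphisms are pairs `(α, β)` making the evident square commute. -/
abbrev HPullback {X : Type u₁} [Groupoid.{v₁} X] {Y : Type u₂} [Groupoid.{v₂} Y]
    {B : Type u₃} [Groupoid.{v₃} B] (F : X ⥤ B) (G : Y ⥤ B) := Comma F G

instance {X : Type u₁} [Groupoid.{v₁} X] {Y : Type u₂} [Groupoid.{v₂} Y]
    {B : Type u₃} [Groupoid.{v₃} B] (F : X ⥤ B) (G : Y ⥤ B) : Groupoid (HPullback F G) where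
  inv f :=
    { left := Groupoid.inv f.left
      right := Groupoid.inv f.right
      w := by
        have h := f.w
        simp only [Groupoid.inv_eq_inv, Functor.map_inv]
        rw [IsIso.inv_comp_eq, ← Category.assoc, IsIso.eq_comp_inv]
        exact h.symm }
  inv_comp f := by ext <;> simp
  comp_inv f := by ext <;> simp

/-- The functor `1 ⥤ B` that picks out the object `b`. -/
abbrev nameOf {B : Type u₁} [Groupoid.{v₁} B] (b : B) : Discrete PUnit.{1} ⥤ B :=
  Functor.fromPUnit b

/-- The homotopy fibre of `F : X ⥤ B` over `b`, i.e. the homotopy pullback of `F` and `⌜b⌝`. -/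
abbrev HFibre {X : Type u₁} [Groupoid.{v₁} X] {B : Type u₂} [Groupoid.{v₂} B]
    (F : X ⥤ B) (b : B) := HPullback F (nameOf b)

/-- A functor of groupoids is finite if all its homotopy fibres are finite. -/
def IsFiniteMap {X : Type u₁} [Groupoid.{v₁} X] {B : Type u₂} [Groupoid.{v₂} B]
    (F : X ⥤ B) : Prop :=
  ∀ b : B, IsFiniteGroupoid (HFibre F b)

/-- The coefficient `|Y_b| / |Aut b|` of the homotopy cardinality of `p : Y ⥤ B`. -/
noncomputable def familyCardCoeff {Y : Type u₁} [Groupoid.{v₁} Y] {B : Type u₂} [Groupoid.{v₂} B]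
    (p : Y ⥤ B) (c : PiZero B) : ℚ :=
  homotopyCard (HFibre p c.rep) / (Nat.card (Aut c.rep) : ℚ)

open scoped Classical in
/-- The homotopy cardinality `|p| = ∑_{b ∈ π₀ B} (|Y_b| / |Aut b|) δ_b` of `p : Y ⥤ B`, a vector in
the vector space spanned by `π₀ B`. (The sum is finite whenever `Y` is a finite groupoid; the value
is `0` by convention if infinitely many coefficients are nonzero.) -/
noncomputable def familyCard {Y : Type u₁} [Groupoid.{v₁} Y] {B : Type u₂} [Groupoid.{v₂} B]
    (p : Y ⥤ B) : PiZero B →₀ ℚ :=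
  if h : (Function.support (familyCardCoeff p)).Finite then
    Finsupp.ofSupportFinite (familyCardCoeff p) h
  else 0

/-- The identification of the space spanned by `π₀ (X × Y)` with the tensor product of the spaces
spanned by `π₀ X` and `π₀ Y`, given by `δ_(x, y) ↦ δ_x ⊗ δ_y`. -/
noncomputable def prodToTensor (X : Type u₁) [Groupoid.{v₁} X] (Y : Type u₂) [Groupoid.{v₂} Y] :
    (PiZero (X × Y) →₀ ℚ) →ₗ[ℚ] (PiZero X →₀ ℚ) ⊗[ℚ] (PiZero Y →₀ ℚ) :=
  Finsupp.linearCombination ℚ fun c : PiZero (X × Y) =>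
    Finsupp.single (PiZero.mk c.rep.1) (1 : ℚ) ⊗ₜ[ℚ] Finsupp.single (PiZero.mk c.rep.2) (1 : ℚ)

end Groupoids

/-! ## Simplicial groupoids and the incidence coalgebra -/

section Simplicial

universe v u v' u'

/-- The groupoid of `n`-simplices of a simplicial groupoid. -/
abbrev simplices (X : SimplicialObject Grpd.{v, u}) (n : ℕ) : Grpd.{v, u} :=
  X.obj (op (SimplexCategory.mk n))

/-- The face map `d_i`, as a functor. -/
def face (X : SimplicialObject Grpd.{v, u}) {n : ℕ} (i : Fin (n + 2)) :
    simplices X (n + 1) ⥤ simplices X n := X.δ i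

/-- The degeneracy map `s_i`, as a functor. -/
def degen (X : SimplicialObject Grpd.{v, u}) {n : ℕ} (i : Fin (n + 1)) :
    simplices X n ⥤ simplices X (n + 1) := X.σ i

/-- The finiteness conditions under which the incidence coalgebra has a homotopy cardinality. -/
structure IsLocallyFiniteSimplicial (X : SimplicialObject Grpd.{v, u}) : Prop where
  locallyFinite : IsLocallyFiniteGroupoid (simplices X 1)
  finite_s₀ : IsFiniteMap (degen X (n := 0) 0)
  finite_d₁ : IsFiniteMap (face X (n := 1) 1)

/-- The objective comultiplication `s ↦ (d₂, d₀)_! (d₁^* s)` on objects of `Grpd / X₁`. -/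
def objComul (X : SimplicialObject Grpd.{v, u}) {S : Type u'} [Groupoid.{v'} S]
    (s : S ⥤ simplices X 1) :
    HPullback s (face X (n := 1) 1) ⥤ simplices X 1 × simplices X 1 :=
  Comma.snd s (face X (n := 1) 1) ⋙ (face X (n := 1) 2).prod' (face X (n := 1) 0)

/-- The objective counit `s ↦ t_! (s₀^* s)`, with values in groupoids. -/
abbrev objCounit (X : SimplicialObject Grpd.{v, u}) {S : Type u'} [Groupoid.{v'} S]
    (s : S ⥤ simplices X 1) := HPullback s (degen X (n := 0) 0)

/-- The homotopy cardinality of the objective comultiplication: the linear map with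
`δ_f = |⌜f⌝| ↦ |(d₂, d₀)_! (d₁^* ⌜f⌝)|`. -/
noncomputable def incidenceComul (X : SimplicialObject Grpd.{v, u}) :
    (PiZero (simplices X 1) →₀ ℚ) →ₗ[ℚ]
      (PiZero (simplices X 1) →₀ ℚ) ⊗[ℚ] (PiZero (simplices X 1) →₀ ℚ) :=
  Finsupp.linearCombination ℚ fun c =>
    prodToTensor _ _ (familyCard (objComul X (nameOf c.rep)))

/-- The homotopy cardinality of the objective counit: the linear map with
`δ_f = |⌜f⌝| ↦ |t_! (s₀^* ⌜f⌝)|`. -/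
noncomputable def incidenceCounit (X : SimplicialObject Grpd.{v, u}) :
    (PiZero (simplices X 1) →₀ ℚ) →ₗ[ℚ] ℚ :=
  Finsupp.linearCombination ℚ fun c => homotopyCard (objCounit X (nameOf c.rep))

/-- The fat nerve of a category `C`: its groupoid of `n`-simplices is the groupoid of functors
`[n] ⥤ C` and natural isomorphisms, and the simplicial operators are given by precomposition. -/
def fatNerve (C : Type u) [Category.{v} C] : SimplicialObject Grpd.{v, max u v} where
  obj Δ := Grpd.of (Core (Fin (Δ.unop.len + 1) ⥤ C))
  map f := Functor.core
    ((Functor.whiskeringLeft _ _ C).obj f.unop.toOrderHom.monotone.functor)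
  map_id _ := rfl
  map_comp _ _ := rfl

end Simplicial

/-! ## Finite sets and surjections -/

/-- The category `𝐒` of finite sets and surjections. -/
structure FinSurj : Type 1 where
  carrier : Type
  [finite : Finite carrier]

namespace FinSurj

instance : CoeSort FinSurj Type := ⟨carrier⟩

instance (X : FinSurj) : Finite X := X.finite

instance : Category FinSurj where
  Hom X Y := {f : X → Y // Function.Surjective f}
  id _ := ⟨id, Function.surjective_id⟩
  comp f g := ⟨g.1 ∘ f.1, g.2.comp f.2⟩

@[ext] theorem hom_ext {X Y : FinSurj} {f g : X ⟶ Y} (h : ∀ x, f.1 x = g.1 x) : f = g :=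
  Subtype.ext (funext h)

@[simp] theorem id_val (X : FinSurj) (x : X) : (𝟙 X : X ⟶ X).1 x = x := rfl

@[simp] theorem comp_val {X Y Z : FinSurj} (f : X ⟶ Y) (g : Y ⟶ Z) (x : X) :
    (f ≫ g).1 x = g.1 (f.1 x) := rfl

/-- A bijection is an isomorphism of `𝐒`. -/
def isoOfEquiv {X Y : FinSurj} (e : X ≃ Y) : X ≅ Y where
  hom := ⟨e, e.surjective⟩
  inv := ⟨e.symm, e.symm.surjective⟩
  hom_inv_id := by ext x; exact e.symm_apply_apply x
  inv_hom_id := by ext x; exact e.apply_symm_apply x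

/-- The empty set. -/
def empty : FinSurj := ⟨Empty⟩

/-- Disjoint union, as a functor `𝐒 × 𝐒 ⥤ 𝐒`. -/
def disjUnion : FinSurj × FinSurj ⥤ FinSurj where
  obj p := ⟨p.1 ⊕ p.2⟩
  map f := ⟨Sum.map f.1.1 f.2.1, f.1.2.sumMap f.2.2⟩
  map_id _ := by ext x; cases x <;> rfl
  map_comp _ _ := by ext x; cases x <;> rfl

/-- The groupoid of `n`-simplices of the fat nerve of `𝐒`; for `n = 1` it is the groupoid `𝕊` of
surjections between finite sets and commutative squares of bijections. -/
abbrev NS (n : ℕ) : Grpd.{0, 1} := simplices (fatNerve FinSurj) n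

/-- The disjoint union `(N𝐒)ₙ × (N𝐒)ₙ ⥤ (N𝐒)ₙ` of chains of surjections. -/
def sumSimplices (n : ℕ) : NS n × NS n ⥤ NS n where
  obj p := ⟨p.1.of.prod' p.2.of ⋙ disjUnion⟩
  map {p q} f := ⟨NatIso.ofComponents
    (fun i => disjUnion.mapIso ((f.1.iso.app i).prod (f.2.iso.app i)))
    (fun {i j} g => by
      change disjUnion.map _ ≫ disjUnion.map _ = disjUnion.map _ ≫ disjUnion.map _
      rw [← disjUnion.map_comp, ← disjUnion.map_comp]
      congr 1
      exact Prod.ext (f.1.iso.hom.naturality g) (f.2.iso.hom.naturality g))⟩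
  map_id p := by
    apply Core.hom_ext
    ext i : 2
    exact disjUnion.map_id _
  map_comp f g := by
    apply Core.hom_ext
    ext i : 2
    exact disjUnion.map_comp (X := (_, _)) (Y := (_, _)) (Z := (_, _))
      (f.1.iso.hom.app i, f.2.iso.hom.app i) (g.1.iso.hom.app i, g.2.iso.hom.app i)

/-- The constant chain at the empty set. -/
def emptySimplex (n : ℕ) : NS n := ⟨(Functor.const _).obj empty⟩

/-- Disjoint union of isomorphism classes of chains of surjections. -/
def addClass (n : ℕ) (a b : PiZero (NS n)) : PiZero (NS n) :=
  Quotient.map₂ (sa := isIsomorphicSetoid (NS n)) (sb := isIsomorphicSetoid (NS n))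
    (sc := isIsomorphicSetoid (NS n)) (fun x y => (sumSimplices n).obj (x, y))
    (fun _ _ ⟨e⟩ _ _ ⟨e'⟩ => ⟨(sumSimplices n).mapIso (e.prod e')⟩) a b

theorem mk_eq_mk {n : ℕ} {x y : NS n} (e : ∀ i, x.of.obj i ≃ y.of.obj i)
    (h : ∀ {i j} (g : i ⟶ j) (a : x.of.obj i),
      e j ((x.of.map g).1 a) = (y.of.map g).1 (e i a)) :
    PiZero.mk x = PiZero.mk y :=
  Quotient.sound (s := isIsomorphicSetoid (NS n))
    ⟨Core.isoMk (NatIso.ofComponents (fun i => isoOfEquiv (e i))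
      (fun g => hom_ext fun a => h g a))⟩

instance : Add (PiZero (NS 1)) := ⟨addClass 1⟩

instance : Zero (PiZero (NS 1)) := ⟨PiZero.mk (emptySimplex 1)⟩

/-- Isomorphism classes of surjections form a commutative monoid under disjoint union. -/
instance : AddCommMonoid (PiZero (NS 1)) where
  add_assoc := by
    rintro ⟨a⟩ ⟨b⟩ ⟨c⟩
    exact mk_eq_mk (fun i => Equiv.sumAssoc _ _ _) (by rintro i j g ((x | x) | x) <;> rfl)
  zero_add := by
    rintro ⟨a⟩
    exact mk_eq_mk (fun i => Equiv.emptySum Empty _) (by rintro i j g (x | x) <;> trivial)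
  add_zero := by
    rintro ⟨a⟩
    exact mk_eq_mk (fun i => Equiv.sumEmpty _ Empty) (by rintro i j g (x | x) <;> trivial)
  add_comm := by
    rintro ⟨a⟩ ⟨b⟩
    exact mk_eq_mk (fun i => Equiv.sumComm _ _) (by rintro i j g (x | x) <;> rfl)
  nsmul := nsmulRec

end FinSurj

/-! ## The incidence bialgebra of `N𝐒` -/

/-- The homotopy cardinality of the incidence bialgebra of `N𝐒`. Its underlying vector space is
spanned by the isomorphism classes of surjections between finite sets, and its product is
`δ_a * δ_b = δ_(a + b)`, where `+` is disjoint union. -/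
def SurjBialg : Type 1 := AddMonoidAlgebra ℚ (PiZero (FinSurj.NS 1))

namespace SurjBialg

open FinSurj

noncomputable instance : CommRing SurjBialg :=
  inferInstanceAs (CommRing (AddMonoidAlgebra ℚ (PiZero (NS 1))))

noncomputable instance : Algebra ℚ SurjBialg :=
  inferInstanceAs (Algebra ℚ (AddMonoidAlgebra ℚ (PiZero (NS 1))))

/-- The underlying vector space. -/
noncomputable def equivFinsupp : SurjBialg ≃ₗ[ℚ] (PiZero (NS 1) →₀ ℚ) :=
  AddMonoidAlgebra.coeffLinearEquiv ℚ

/-- The basis vector `δ_f` of a surjection `f`. -/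
noncomputable def basisVector (f : NS 1) : SurjBialg :=
  equivFinsupp.symm (Finsupp.single (PiZero.mk f) 1)

noncomputable instance : CoalgebraStruct ℚ SurjBialg where
  comul := TensorProduct.map equivFinsupp.symm.toLinearMap equivFinsupp.symm.toLinearMap ∘ₗ
    incidenceComul (fatNerve FinSurj) ∘ₗ equivFinsupp.toLinearMap
  counit := incidenceCounit (fatNerve FinSurj) ∘ₗ equivFinsupp.toLinearMap

/-- The surjection `n ↠ 1`, for `n ≥ 1`. -/
def toPoint (n : ℕ+) : (⟨Fin n⟩ : FinSurj) ⟶ ⟨Fin 1⟩ :=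
  ⟨fun _ => 0, fun _ => ⟨⟨0, n.pos⟩, Subsingleton.elim _ _⟩⟩

/-- The class `δ_n` of the surjection `n ↠ 1`. -/
noncomputable def δ (n : ℕ+) : SurjBialg := basisVector ⟨ComposableArrows.mk₁ (toPoint n)⟩

end SurjBialg

/-! ## The Faà di Bruno bialgebra -/

/-- The free algebra `ℚ[A₁, A₂, …]`. -/
abbrev FaaDiBruno : Type := MvPolynomial ℕ+ ℚ

namespace FaaDiBruno

/-- The generator `Aₙ`. -/
noncomputable def A (n : ℕ+) : FaaDiBruno := MvPolynomial.X n

/-- The functional `F ↦ dⁿF/dxⁿ (0)` on power series. -/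
noncomputable def derivAtZero {R : Type*} [CommRing R] (n : ℕ) (F : PowerSeries R) : R :=
  PowerSeries.constantCoeff ((PowerSeries.derivative R)^[n] F)

/-- Polynomials in the `Aₙ` as functions of a power series, with `Aₙ(F) = dⁿF/dxⁿ (0)`. -/
noncomputable def evalAt (F : PowerSeries ℚ) : FaaDiBruno →ₐ[ℚ] ℚ :=
  MvPolynomial.aeval fun n : ℕ+ => derivAtZero n F

/-- Evaluation of `p ⊗ q` at `F ⊗ G`, namely `p(F) q(G)`. -/
noncomputable def evalAt₂ (F G : PowerSeries ℚ) : FaaDiBruno ⊗[ℚ] FaaDiBruno →ₐ[ℚ] ℚ :=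
  Algebra.TensorProduct.lift (evalAt F) (evalAt G) (fun _ _ => Commute.all _ _)

/-- `Δ` is dual to substitution of power series: `Δ(Aₙ)(F ⊗ G) = Aₙ(G ∘ F)`. -/
def IsDualToSubstitution (Δ : FaaDiBruno →ₐ[ℚ] FaaDiBruno ⊗[ℚ] FaaDiBruno) : Prop :=
  ∀ (n : ℕ+) (F G : PowerSeries ℚ), PowerSeries.constantCoeff F = 0 →
    evalAt₂ F G (Δ (A n)) = derivAtZero n (G.subst F)

/-- The power series `∑_{n ≥ 1} aₙ xⁿ / n!`. -/
noncomputable def expSeries {R : Type*} [CommRing R] [Algebra ℚ R] (a : ℕ+ → R) :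
    PowerSeries R :=
  PowerSeries.mk fun n =>
    if h : 0 < n then algebraMap ℚ R (1 / (n.factorial : ℚ)) * a ⟨n, h⟩ else 0

/-- The comultiplication dual to substitution: `Δ(Aₙ) = Aₙ(G ∘ F)` for the two universal power
series `F = ∑ (Aₙ ⊗ 1) xⁿ / n!` and `G = ∑ (1 ⊗ Aₙ) xⁿ / n!`. -/
noncomputable def comulAlgHom : FaaDiBruno →ₐ[ℚ] FaaDiBruno ⊗[ℚ] FaaDiBruno :=
  MvPolynomial.aeval fun n : ℕ+ =>
    derivAtZero n ((expSeries fun k => (1 : FaaDiBruno) ⊗ₜ[ℚ] A k).subst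
      (expSeries fun k => A k ⊗ₜ[ℚ] (1 : FaaDiBruno)))

/-- The counit is evaluation at `x`, the unit for substitution. -/
noncomputable instance : CoalgebraStruct ℚ FaaDiBruno where
  comul := comulAlgHom.toLinearMap
  counit := (evalAt PowerSeries.X).toLinearMap

end FaaDiBruno

/-! ## Bialgebras -/

/-- The comultiplication and the counit make the algebra `A` a bialgebra over `R`. -/
structure IsBialgebra (R A : Type*) [CommSemiring R] [Semiring A] [Algebra R A]
    [CoalgebraStruct R A] : Prop where
  coassoc : TensorProduct.assoc R A A A ∘ₗ
      (CoalgebraStruct.comul (R := R) (A := A)).rTensor A ∘ₗ CoalgebraStruct.comul =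
    (CoalgebraStruct.comul (R := R) (A := A)).lTensor A ∘ₗ CoalgebraStruct.comul
  counit_left : (CoalgebraStruct.counit (R := R) (A := A)).rTensor A ∘ₗ CoalgebraStruct.comul =
    TensorProduct.mk R R A 1
  counit_right : (CoalgebraStruct.counit (R := R) (A := A)).lTensor A ∘ₗ CoalgebraStruct.comul =
    (TensorProduct.mk R A R).flip 1
  comul_one : CoalgebraStruct.comul (R := R) (1 : A) = 1
  comul_mul : ∀ a b : A, CoalgebraStruct.comul (R := R) (a * b) =
    CoalgebraStruct.comul a * CoalgebraStruct.comul b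
  counit_one : CoalgebraStruct.counit (R := R) (1 : A) = 1
  counit_mul : ∀ a b : A, CoalgebraStruct.counit (R := R) (a * b) =
    CoalgebraStruct.counit a * CoalgebraStruct.counit b

/-! An object of the homotopy pullback of `d_1` along the name of a surjection `f : A ↠ C` is a
factorization of `f` into two surjections. Surjections are epimorphisms, so such factorizations have
no nontrivial automorphisms, and every homotopy cardinality that occurs is an ordinary count. Up to
isomorphism a factorization is the same as an equivalence relation `r` contained in the kernel of
`f` (`bijective_mk_factorization`). Hence the comultiplication of `δ_f` is the sum over these `r` of
the class of `A ↠ A/r` tensor the class of `A/r ↠ C` (`incidenceComul_single_cls`).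

The bialgebra axioms become statements about equivalence relations. Coassociativity counts chains `s
≤ r ≤ ker f` in two ways. The counit laws isolate the two extreme relations. Multiplicativity holds
because a relation below `f + g` splits into one below `f` and one below `g`.

A surjection is the disjoint union of its fibres over points, so classes of surjections form the
free commutative monoid on the `n ↠ 1` (`finsuppEquivPiZero`), and the algebra is polynomial on the
`δ n`. For `n ↠ 1` the comultiplication is a sum over all set partitions of `n`: block sizes on the
left, number of blocks on the right (`comul_δ`). Faà di Bruno's formula (`derivAtZero_subst`) gives
the same sum for the Taylor coefficients of `G ∘ F`. So `A n ↦ δ n` respects both structures, and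
the bialgebra axioms on the power series side are inherited through it. Uniqueness of the dual
comultiplication holds because polynomials over `ℚ` are determined by their values at rational
points. -/

section Groupoids

-- Homotopy cardinality of thin groupoids.

universe v₁ v₂ v₃ u₁ u₂ u₃

theorem PiZero.mk_eq_mk_iff {X : Type u₁} [Groupoid.{v₁} X] {x y : X} :
    PiZero.mk x = PiZero.mk y ↔ Nonempty (x ≅ y) :=
  Quotient.eq (r := isIsomorphicSetoid X)

theorem PiZero.mk_rep {X : Type u₁} [Groupoid.{v₁} X] (c : PiZero X) : PiZero.mk c.rep = c :=
  Quotient.out_eq (s := isIsomorphicSetoid X) c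

theorem PiZero.mk_surjective {X : Type u₁} [Groupoid.{v₁} X] :
    Function.Surjective (PiZero.mk (X := X)) := fun c => ⟨c.rep, c.mk_rep⟩

theorem PiZero.mk_eq_of_hom {X : Type u₁} [Groupoid.{v₁} X] {x y : X} (f : x ⟶ y) :
    PiZero.mk x = PiZero.mk y :=
  PiZero.mk_eq_mk_iff.2 ⟨Groupoid.isoEquivHom _ _ |>.symm f⟩

theorem PiZero.hom_of_mk_eq {X : Type u₁} [Groupoid.{v₁} X] {x y : X}
    (h : PiZero.mk x = PiZero.mk y) : Nonempty (x ⟶ y) :=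
  (PiZero.mk_eq_mk_iff.1 h).map Iso.hom

theorem PiZero.mk_map_eq {X : Type u₁} [Groupoid.{v₁} X] {Y : Type u₂} [Groupoid.{v₂} Y]
    (F : X ⥤ Y) {x y : X} (h : PiZero.mk x = PiZero.mk y) :
    PiZero.mk (F.obj x) = PiZero.mk (F.obj y) := by
  obtain ⟨e⟩ := PiZero.hom_of_mk_eq h
  exact PiZero.mk_eq_of_hom (F.map e)

theorem subsingleton_aut {X : Type u₁} [Groupoid.{v₁} X] [Quiver.IsThin X] (x : X) :
    Subsingleton (Aut x) :=
  ⟨fun _ _ => Iso.ext (Subsingleton.elim (α := x ⟶ x) _ _)⟩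

theorem isFiniteGroupoid_of_isThin (X : Type u₁) [Groupoid.{v₁} X] [Quiver.IsThin X]
    [Finite (PiZero X)] : IsFiniteGroupoid X :=
  ⟨inferInstance, fun x => by have := subsingleton_aut x; infer_instance⟩

theorem homotopyCard_of_isThin (X : Type u₁) [Groupoid.{v₁} X] [Quiver.IsThin X]
    [Finite (PiZero X)] : homotopyCard X = Nat.card (PiZero X) := by
  have := Fintype.ofFinite (PiZero X)
  have h : ∀ c : PiZero X, Nat.card (Aut c.rep) = 1 := fun c => by
    have := subsingleton_aut c.rep
    exact Nat.card_unique
  simp [homotopyCard, h, finsum_eq_sum_of_fintype]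

variable {X : Type u₁} [Groupoid.{v₁} X] {Y : Type u₂} [Groupoid.{v₂} Y]
  {B : Type u₃} [Groupoid.{v₃} B]

instance HFibre.isThin [Quiver.IsThin Y] (p : Y ⥤ B) (b : B) : Quiver.IsThin (HFibre p b) :=
  fun _ _ => ⟨fun _ _ => Comma.hom_ext _ _ (Subsingleton.elim _ _) (Subsingleton.elim _ _)⟩

/-- Inverting the comparison arrow exchanges the two legs. The exchange is needed because the
finiteness conditions use fibres with the name of a point on the right, while the comultiplication
and counit have it on the left. -/
theorem HPullback.isThin_swap (F : X ⥤ B) (G : Y ⥤ B) [Quiver.IsThin (HPullback F G)] :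
    Quiver.IsThin (HPullback G F) := by
  intro x y
  refine ⟨fun f g => ?_⟩
  let S (z : HPullback G F) : HPullback F G := ⟨z.right, z.left, Groupoid.inv z.hom⟩
  let M (h : x ⟶ y) : S x ⟶ S y := ⟨h.right, h.left, by
    have := h.w
    simp only [S, Groupoid.inv_eq_inv]
    rw [IsIso.eq_inv_comp, ← Category.assoc, ← this, Category.assoc, IsIso.hom_inv_id,
      Category.comp_id]⟩
  have h : M f = M g := Subsingleton.elim _ _
  exact Comma.hom_ext _ _ (congrArg CommaMorphism.right h) (congrArg CommaMorphism.left h)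

theorem HPullback.finite_piZero_swap (F : X ⥤ B) (G : Y ⥤ B) [Finite (PiZero (HPullback F G))] :
    Finite (PiZero (HPullback G F)) := by
  let S (z : HPullback F G) : HPullback G F := ⟨z.right, z.left, Groupoid.inv z.hom⟩
  refine Finite.of_surjective (fun c : PiZero (HPullback F G) => PiZero.mk (S c.rep)) fun d => ?_
  obtain ⟨z, rfl⟩ := PiZero.mk_surjective d
  let w : HPullback F G := ⟨z.right, z.left, Groupoid.inv z.hom⟩
  refine ⟨PiZero.mk w, ?_⟩
  obtain ⟨h⟩ := PiZero.hom_of_mk_eq (PiZero.mk w).mk_rep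
  refine PiZero.mk_eq_of_hom (y := z) ⟨h.right, h.left, ?_⟩
  have := h.w
  simp only [w, S, Groupoid.inv_eq_inv] at this ⊢
  rw [IsIso.eq_inv_comp, ← Category.assoc, ← this, Category.assoc, IsIso.inv_hom_id,
    Category.comp_id]

-- In a groupoid, a nonempty set of arrows into `b` is a torsor under `Aut b`.
open scoped Classical in
theorem card_hom_eq (x b : B) :
    Nat.card (x ⟶ b) = if PiZero.mk x = PiZero.mk b then Nat.card (Aut b) else 0 := by
  split_ifs with h
  · obtain ⟨e⟩ := PiZero.hom_of_mk_eq h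
    exact Nat.card_congr
      { toFun := fun f => (Groupoid.isoEquivHom _ _).symm (Groupoid.inv e ≫ f)
        invFun := fun a => e ≫ a.hom
        left_inv := fun f => by simp [Groupoid.isoEquivHom]
        right_inv := fun a => Iso.ext (by simp [Groupoid.isoEquivHom]) }
  · have : IsEmpty (x ⟶ b) := ⟨fun f => h (PiZero.mk_eq_of_hom f)⟩
    exact Nat.card_of_isEmpty

/-- When `Y` is thin, an isomorphism in the fibre between two points over the same representative is
the identity on that representative, so distinct comparison arrows give distinct classes. -/
theorem bijective_sigma_to_piZero_hFibre [Quiver.IsThin Y] (p : Y ⥤ B) (b : B) :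
    Function.Bijective fun z : (c : PiZero Y) × (p.obj c.rep ⟶ b) =>
      PiZero.mk (X := HFibre p b) ⟨z.1.rep, ⟨PUnit.unit⟩, z.2⟩ := by
  constructor
  · rintro ⟨c, f⟩ ⟨d, g⟩ h
    obtain ⟨k⟩ := PiZero.hom_of_mk_eq h
    have hl : c.rep ⟶ d.rep := k.left
    obtain rfl : c = d := by rw [← c.mk_rep, ← d.mk_rep]; exact PiZero.mk_eq_of_hom hl
    have hk : k.left = 𝟙 c.rep := Subsingleton.elim _ _
    have := k.w
    simp [hk] at this
    rw [this]
  · intro d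
    obtain ⟨z, rfl⟩ := PiZero.mk_surjective d
    obtain ⟨e⟩ := PiZero.hom_of_mk_eq (PiZero.mk z.left).mk_rep
    refine ⟨⟨PiZero.mk z.left, p.map e ≫ z.hom⟩, PiZero.mk_eq_of_hom ⟨e, 𝟙 _, ?_⟩⟩
    simp

/-- The fibre over `b` is thin, and each class of `Y` lying over `b` contributes `|Aut b|` points to
it. This cancels the denominator `|Aut b|`, leaving a plain count. -/
theorem familyCard_of_isThin [Quiver.IsThin Y] [Fintype (PiZero Y)]
    (hB : IsLocallyFiniteGroupoid B) (p : Y ⥤ B) :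
    familyCard p = ∑ c : PiZero Y, Finsupp.single (PiZero.mk (p.obj c.rep)) (1 : ℚ) := by
  classical
  have hfin (x b : B) : Finite (x ⟶ b) := by
    by_cases h : Nonempty (x ⟶ b)
    · obtain ⟨e⟩ := h
      have := hB b
      refine Finite.of_surjective (fun a : Aut b => e ≫ a.hom) fun f =>
        ⟨(Groupoid.isoEquivHom _ _).symm (Groupoid.inv e ≫ f), by simp [Groupoid.isoEquivHom]⟩
    · have := not_nonempty_iff.1 h
      infer_instance
  have hc (d : PiZero B) : familyCardCoeff p d =
      ∑ c : PiZero Y, if PiZero.mk (p.obj c.rep) = d then (1 : ℚ) else 0 := by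
    have := hfin
    have hbij := bijective_sigma_to_piZero_hFibre p d.rep
    have : Finite (PiZero (HFibre p d.rep)) := Finite.of_surjective _ hbij.2
    have hpos : (Nat.card (Aut d.rep) : ℚ) ≠ 0 := by
      have := hB d.rep
      exact_mod_cast Nat.card_pos.ne'
    rw [familyCardCoeff, homotopyCard_of_isThin, ← Nat.card_eq_of_bijective _ hbij, Nat.card_sigma,
      Nat.cast_sum, Finset.sum_div]
    refine Finset.sum_congr rfl fun c _ => ?_
    rw [card_hom_eq, d.mk_rep]
    split_ifs <;> simp [hpos]
  have hs : familyCardCoeff p =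
      ⇑(∑ c : PiZero Y, Finsupp.single (PiZero.mk (p.obj c.rep)) (1 : ℚ)) := by
    ext d
    rw [hc, Finsupp.finsetSum_apply]
    exact Finset.sum_congr rfl fun c _ => by rw [Finsupp.single_apply]
  have hf : (Function.support (familyCardCoeff p)).Finite := by
    rw [hs]; exact Finsupp.hasFiniteSupport _
  rw [familyCard, dif_pos hf]
  exact DFunLike.coe_injective hs

theorem prodToTensor_single_mk (x : X) (y : Y) :
    prodToTensor X Y (Finsupp.single (PiZero.mk (x, y)) 1) =
      Finsupp.single (PiZero.mk x) (1 : ℚ) ⊗ₜ[ℚ] Finsupp.single (PiZero.mk y) (1 : ℚ) := by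
  have h := (PiZero.mk (x, y)).mk_rep
  have h₁ := PiZero.mk_map_eq (CategoryTheory.Prod.fst X Y) h
  have h₂ := PiZero.mk_map_eq (CategoryTheory.Prod.snd X Y) h
  simp only [CategoryTheory.Prod.fst_obj, CategoryTheory.Prod.snd_obj] at h₁ h₂
  rw [prodToTensor, Finsupp.linearCombination_single, one_smul, h₁, h₂]

end Groupoids

/-! ### Factorizations of surjections and equivalence relations. -/

namespace FinSurj

/-- The equivalence underlying a component of a morphism of chains of surjections. -/
def component {n : ℕ} {x y : NS n} (h : x ⟶ y) (i : Fin (n + 1)) : x.of.obj i ≃ y.of.obj i where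
  toFun := (h.iso.hom.app i).1
  invFun := (h.iso.inv.app i).1
  left_inv a := congrFun (congrArg Subtype.val (h.iso.hom_inv_id_app i)) a
  right_inv a := congrFun (congrArg Subtype.val (h.iso.inv_hom_id_app i)) a

theorem component_naturality {n : ℕ} {x y : NS n} (h : x ⟶ y) {i j : Fin (n + 1)} (g : i ⟶ j)
    (a : x.of.obj i) :
    component h j ((x.of.map g).1 a) = (y.of.map g).1 (component h i a) :=
  congrFun (congrArg Subtype.val (h.iso.hom.naturality g)) a

theorem hom_ext_component {n : ℕ} {x y : NS n} {h k : x ⟶ y}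
    (e : ∀ i a, component h i a = component k i a) : h = k := by
  apply Core.hom_ext
  ext i a
  exact e i a

theorem component_inv_apply {n : ℕ} {x y : NS n} (h : x ⟶ y) (i : Fin (n + 1)) (a : x.of.obj i) :
    component (Groupoid.inv h) i (component h i a) = a :=
  (component h i).symm_apply_apply a

/-- A surjection, as a 1-simplex. -/
def arr {A B : FinSurj} (f : A ⟶ B) : NS 1 := ⟨ComposableArrows.mk₁ f⟩

/-- A composable pair of surjections, as a 2-simplex. -/
def chain {A B C : FinSurj} (f : A ⟶ B) (g : B ⟶ C) : NS 2 := ⟨ComposableArrows.mk₂ f g⟩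

/-- The isomorphism class of a surjection. -/
def cls {A B : FinSurj} (f : A ⟶ B) : PiZero (NS 1) := PiZero.mk (arr f)

/-- The surjections in a chain. -/
def step {n : ℕ} (x : NS n) (i j : Fin (n + 1)) (h : i ≤ j := by decide) :
    x.of.obj i ⟶ x.of.obj j :=
  x.of.map (homOfLE h)

/-- The surjection underlying a 1-simplex. -/
def toMap (x : NS 1) : x.of.obj 0 ⟶ x.of.obj 1 := step x 0 1

/-- A morphism of 1-simplices, from a commutative square of bijections. -/
def homMk₁ {x y : NS 1} (e₀ : x.of.obj 0 ≃ y.of.obj 0) (e₁ : x.of.obj 1 ≃ y.of.obj 1)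
    (w : ∀ a, e₁ ((toMap x).1 a) = (toMap y).1 (e₀ a)) : x ⟶ y :=
  ⟨ComposableArrows.isoMk₁ (isoOfEquiv e₀) (isoOfEquiv e₁) (hom_ext w)⟩

/-- A morphism of 2-simplices, from a commutative diagram of bijections. -/
def homMk₂ {x y : NS 2} (e₀ : x.of.obj 0 ≃ y.of.obj 0) (e₁ : x.of.obj 1 ≃ y.of.obj 1)
    (e₂ : x.of.obj 2 ≃ y.of.obj 2)
    (w₀ : ∀ a, e₁ ((step x 0 1).1 a) = (step y 0 1).1 (e₀ a))
    (w₁ : ∀ a, e₂ ((step x 1 2).1 a) = (step y 1 2).1 (e₁ a)) : x ⟶ y :=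
  ⟨ComposableArrows.isoMk₂ (isoOfEquiv e₀) (isoOfEquiv e₁) (isoOfEquiv e₂) (hom_ext w₀)
    (hom_ext w₁)⟩

theorem mk_eq_cls (x : NS 1) : PiZero.mk x = cls (toMap x) :=
  PiZero.mk_eq_of_hom (homMk₁ (Equiv.refl _) (Equiv.refl _) fun _ => rfl)

theorem cls_eq_cls {A B A' B' : FinSurj} {f : A ⟶ B} {g : A' ⟶ B'} (e : A ≃ A') (e' : B ≃ B')
    (h : ∀ a, e' (f.1 a) = g.1 (e a)) : cls f = cls g :=
  PiZero.mk_eq_of_hom (homMk₁ (x := arr f) (y := arr g) e e' h)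

theorem mk_face_two_chain {A B C : FinSurj} (f : A ⟶ B) (g : B ⟶ C) :
    PiZero.mk ((face (fatNerve FinSurj) (n := 1) 2).obj (chain f g)) = cls f :=
  mk_eq_cls _

theorem isLocallyFiniteGroupoid_NS (n : ℕ) : IsLocallyFiniteGroupoid (NS n) := fun x =>
  Finite.of_injective (fun (a : Aut x) (i : Fin (n + 1)) => component (x := x) (y := x) a.hom i)
    fun _ _ h => Iso.ext <| hom_ext_component fun i a =>
      DFunLike.congr_fun (congrFun h i) a

/-- The comparison with `s` fixes the two outer components of a map of factorizations. The middle
one is then forced by naturality, because the first map of the chain is surjective. -/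
instance isThin_hPullback_face_one {S : Type*} [Groupoid S] [Quiver.IsThin S] (s : S ⥤ NS 1) :
    Quiver.IsThin (HPullback s (face (fatNerve FinSurj) (n := 1) 1)) := by
  intro z w
  refine ⟨fun k l => Comma.hom_ext _ _ (Subsingleton.elim _ _) ?_⟩
  have h : (face (fatNerve FinSurj) (n := 1) 1).map k.right =
      (face (fatNerve FinSurj) (n := 1) 1).map l.right := by
    have hk := k.w
    have hl := l.w
    rw [Subsingleton.elim k.left l.left, hl] at hk
    exact (cancel_epi _).1 hk.symm
  have h₀ (a : z.right.of.obj 0) : component k.right 0 a = component l.right 0 a :=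
    DFunLike.congr_fun (congrArg (fun m => component m 0) h) a
  have h₂ (a : z.right.of.obj 2) : component k.right 2 a = component l.right 2 a :=
    DFunLike.congr_fun (congrArg (fun m => component m 1) h) a
  apply hom_ext_component
  intro i
  fin_cases i
  · exact h₀
  · intro a
    obtain ⟨b, rfl⟩ := (step z.right 0 1).2 a
    exact (component_naturality _ _ _).trans ((congrArg _ (h₀ b)).trans
      (component_naturality _ _ _).symm)
  · exact h₂

instance isThin_hPullback_degen {S : Type*} [Groupoid S] [Quiver.IsThin S] (s : S ⥤ NS 1) :
    Quiver.IsThin (HPullback s (degen (fatNerve FinSurj) (n := 0) 0)) := by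
  intro z w
  refine ⟨fun k l => Comma.hom_ext _ _ (Subsingleton.elim _ _) ?_⟩
  have h : (degen (fatNerve FinSurj) (n := 0) 0).map k.right =
      (degen (fatNerve FinSurj) (n := 0) 0).map l.right := by
    have hk := k.w
    have hl := l.w
    rw [Subsingleton.elim k.left l.left, hl] at hk
    exact (cancel_epi _).1 hk.symm
  apply hom_ext_component
  intro i a
  obtain rfl : i = 0 := Fin.fin_one_eq_zero i
  exact DFunLike.congr_fun (congrArg (fun m => component m 0) h) a

/-- The equivalence relations that are finer than the kernel of a surjection, which index its
factorizations up to isomorphism. -/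
@[ext]
structure Below {A C : FinSurj} (f : A ⟶ C) where
  /-- The equivalence relation. -/
  rel : Setoid A
  le : rel ≤ Setoid.ker f.1

instance {A : Type*} [Finite A] : Finite (Setoid A) :=
  Finite.of_injective (fun r : Setoid A => fun a b => r a b) fun _ _ h =>
    Setoid.ext fun a b => iff_of_eq (congrFun (congrFun h a) b)

instance {A C : FinSurj} (f : A ⟶ C) : Finite (Below f) :=
  Finite.of_injective Below.rel fun _ _ => Below.ext

noncomputable instance {A C : FinSurj} (f : A ⟶ C) : Fintype (Below f) := Fintype.ofFinite _

/-- The quotient of a finite set by an equivalence relation. -/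
def quot {A : FinSurj} (r : Setoid A) : FinSurj := ⟨Quotient r⟩

/-- The projection to the quotient. -/
def proj {A : FinSurj} (r : Setoid A) : A ⟶ quot r := ⟨Quotient.mk r, Quotient.mk_surjective⟩

/-- The second factor of a surjection, given its first factor. -/
def desc {A C : FinSurj} {f : A ⟶ C} (r : Below f) : quot r.1 ⟶ C :=
  ⟨Quotient.lift f.1 fun _ _ h => r.2 h, fun c => (f.2 c).imp' (Quotient.mk _) fun _ h => h⟩

theorem proj_eq_iff {A : FinSurj} (r : Setoid A) (a b : A) :
    (proj r).1 a = (proj r).1 b ↔ r a b := Quotient.eq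

/-- The factorization with given kernel. -/
def factorization {A C : FinSurj} (f : A ⟶ C) {x : NS 1} (h : x ⟶ arr f) (r : Below f) :
    HPullback (nameOf x) (face (fatNerve FinSurj) (n := 1) 1) :=
  ⟨⟨PUnit.unit⟩, chain (proj r.1) (desc r), h ≫
    homMk₁ (y := (face (fatNerve FinSurj) (n := 1) 1).obj (chain (proj r.1) (desc r)))
      (Equiv.refl A) (Equiv.refl C) fun _ => rfl⟩

/-- The invariant of a factorization `A ↠ B ↠ C` is the kernel of `A ↠ B`, and the factorization is
recovered from it by the first isomorphism theorem. -/
theorem bijective_mk_factorization {A C : FinSurj} (f : A ⟶ C) {x : NS 1} (h : x ⟶ arr f) :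
    Function.Bijective fun r : Below f => PiZero.mk (factorization f h r) := by
  constructor
  · intro r s hrs
    obtain ⟨k⟩ := PiZero.hom_of_mk_eq hrs
    -- `k` is compatible with the comparisons with `x`, and both chains start at `A` itself through
    -- the same `h`.
    have h₀ (a : A) : component k.right 0 a = a := by
      have hw := k.w
      obtain ⟨b, rfl⟩ := (component h 0).surjective a
      have := DFunLike.congr_fun (congrArg (fun m => component m 0) hw) b
      exact this.symm
    have h₁ (a : A) : component k.right 1 ((proj r.1).1 a) = (proj s.1).1 a := by
      refine (component_naturality k.right (homOfLE (by decide : (0 : Fin 3) ≤ 1)) a).trans ?_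
      exact congrArg _ (h₀ a)
    refine Below.ext (Setoid.ext fun a b => ?_)
    rw [← proj_eq_iff, ← proj_eq_iff, ← h₁, ← h₁]
    exact (component k.right 1).injective.eq_iff.symm
  · intro d
    obtain ⟨⟨⟨⟨⟩⟩, σ, φ⟩, rfl⟩ := PiZero.mk_surjective d
    -- Cancelling `h` compares `σ` with `f` directly; the relation sought is then the kernel of the
    -- composite `A ≃ σ₀ ↠ σ₁`.
    let ψ : arr f ⟶ (face (fatNerve FinSurj) (n := 1) 1).obj σ := Groupoid.inv h ≫ φ
    let e₀ : A ≃ σ.of.obj 0 := component ψ 0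
    let e₂ : C ≃ σ.of.obj 2 := component ψ 1
    let g : A → σ.of.obj 1 := fun a => (step σ 0 1).1 (e₀ a)
    have hg : Function.Surjective g := (step σ 0 1).2.comp e₀.surjective
    have hψ (a : A) : e₂ (f.1 a) = (step σ 1 2).1 (g a) := by
      refine (component_naturality ψ (homOfLE (by decide : (0 : Fin 2) ≤ 1)) a).trans ?_
      exact congrFun (congrArg Subtype.val (σ.of.map_comp
        (homOfLE (by decide : (0 : Fin 3) ≤ 1)) (homOfLE (by decide : (1 : Fin 3) ≤ 2)))) (e₀ a)
    let r : Below f := ⟨Setoid.ker g, fun a b hab => e₂.injective (by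
      rw [hψ, hψ, show g a = g b from hab])⟩
    let e₁ : Quotient r.1 ≃ σ.of.obj 1 := Setoid.quotientKerEquivOfSurjective g hg
    refine ⟨r, PiZero.mk_eq_of_hom ⟨𝟙 _, homMk₂ (x := chain (proj r.1) (desc r)) e₀ e₁ e₂
      (fun a => rfl) ?_, ?_⟩⟩
    · rintro ⟨a⟩
      exact hψ a
    · apply hom_ext_component
      intro i a
      fin_cases i
      · exact (congrArg (component φ 0) (component_inv_apply h 0 a)).symm
      · exact (congrArg (component φ 1) (component_inv_apply h 1 a)).symm

theorem finite_piZero_factorizations (x : NS 1) :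
    Finite (PiZero (HPullback (nameOf x) (face (fatNerve FinSurj) (n := 1) 1))) := by
  obtain ⟨h⟩ := PiZero.hom_of_mk_eq (mk_eq_cls x)
  exact Finite.of_surjective _ (bijective_mk_factorization (toMap x) h).2

/-- Two presentations of `x` as an identity map differ by an isomorphism between identity maps. Its
two components agree by naturality, so it is a degeneracy. -/
theorem subsingleton_piZero_objCounit (x : NS 1) :
    Subsingleton (PiZero (objCounit (fatNerve FinSurj) (nameOf x))) := by
  refine ⟨fun c d => ?_⟩
  obtain ⟨⟨⟨⟨⟩⟩, σ, φ⟩, rfl⟩ := PiZero.mk_surjective c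
  obtain ⟨⟨⟨⟨⟩⟩, τ, ψ⟩, rfl⟩ := PiZero.mk_surjective d
  let χ : (degen (fatNerve FinSurj) (n := 0) 0).obj σ ⟶
    (degen (fatNerve FinSurj) (n := 0) 0).obj τ := Groupoid.inv φ ≫ ψ
  let e : σ.of.obj 0 ≃ τ.of.obj 0 := component χ 0
  let k : σ ⟶ τ := ⟨ComposableArrows.isoMk₀ (isoOfEquiv e)⟩
  have h₁ (a : σ.of.obj 0) : component χ 1 a = e a := by
    have := component_naturality χ (homOfLE (by decide : (0 : Fin 2) ≤ 1)) a
    have hσ : (((degen (fatNerve FinSurj) (n := 0) 0).obj σ).of.map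
      (homOfLE (by decide : (0 : Fin 2) ≤ 1))).1 a = a :=
      congrFun (congrArg Subtype.val (σ.of.map_id 0)) a
    have hτ : (((degen (fatNerve FinSurj) (n := 0) 0).obj τ).of.map
      (homOfLE (by decide : (0 : Fin 2) ≤ 1))).1 (e a) = e a :=
      congrFun (congrArg Subtype.val (τ.of.map_id 0)) (e a)
    rw [hσ] at this
    exact this.trans hτ
  have hk : (degen (fatNerve FinSurj) (n := 0) 0).map k = χ := by
    apply hom_ext_component
    intro i a
    fin_cases i
    · rfl
    · exact (h₁ a).symm
  refine PiZero.mk_eq_of_hom ⟨𝟙 _, k, ?_⟩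
  simp [hk, χ]

theorem isLocallyFiniteSimplicial_fatNerve : IsLocallyFiniteSimplicial (fatNerve FinSurj) where
  locallyFinite := isLocallyFiniteGroupoid_NS 1
  finite_s₀ x := by
    have := subsingleton_piZero_objCounit x
    have := isThin_hPullback_degen (nameOf x)
    have := HPullback.isThin_swap (nameOf x) (degen (fatNerve FinSurj) (n := 0) 0)
    have := HPullback.finite_piZero_swap (nameOf x) (degen (fatNerve FinSurj) (n := 0) 0)
    exact isFiniteGroupoid_of_isThin _
  finite_d₁ x := by
    have := finite_piZero_factorizations x
    have := HPullback.isThin_swap (nameOf x) (face (fatNerve FinSurj) (n := 1) 1)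
    have := HPullback.finite_piZero_swap (nameOf x) (face (fatNerve FinSurj) (n := 1) 1)
    exact isFiniteGroupoid_of_isThin _

theorem exists_eq_cls (c : PiZero (NS 1)) : ∃ (A C : FinSurj) (f : A ⟶ C), c = cls f := by
  obtain ⟨x, rfl⟩ := PiZero.mk_surjective c
  exact ⟨_, _, _, mk_eq_cls x⟩

/-- Factorizations form a thin groupoid, so `familyCard_of_isThin` turns the homotopy cardinality
into a sum over isomorphism classes, which `bijective_mk_factorization` reindexes. -/
theorem incidenceComul_single_cls {A C : FinSurj} (f : A ⟶ C) :
    incidenceComul (fatNerve FinSurj) (Finsupp.single (cls f) 1) =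
      ∑ r : Below f, Finsupp.single (cls (proj r.1)) (1 : ℚ) ⊗ₜ[ℚ]
        Finsupp.single (cls (desc r)) (1 : ℚ) := by
  obtain ⟨h⟩ := PiZero.hom_of_mk_eq (cls f).mk_rep
  have hbij := bijective_mk_factorization f h
  have := finite_piZero_factorizations (cls f).rep
  have := Fintype.ofFinite
    (PiZero (HPullback (nameOf (cls f).rep) (face (fatNerve FinSurj) (n := 1) 1)))
  have hB : IsLocallyFiniteGroupoid (NS 1 × NS 1) := fun x => by
    have h₁ := isLocallyFiniteGroupoid_NS 1 x.1
    have h₂ := isLocallyFiniteGroupoid_NS 1 x.2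
    refine Finite.of_injective (β := Aut x.1 × Aut x.2)
      (fun a => ((CategoryTheory.Prod.fst _ _).mapIso a, (CategoryTheory.Prod.snd _ _).mapIso a))
      fun a b hab => Iso.ext (Prod.ext ?_ ?_)
    · exact congrArg (fun p => p.1.hom) hab
    · exact congrArg (fun p => p.2.hom) hab
  rw [incidenceComul, Finsupp.linearCombination_single, one_smul, familyCard_of_isThin hB, map_sum]
  refine (Fintype.sum_bijective _ hbij _ _ fun r => ?_).symm
  rw [PiZero.mk_map_eq (objComul (fatNerve FinSurj) (nameOf (cls f).rep))
    (PiZero.mk (factorization f h r)).mk_rep]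
  refine Eq.trans ?_ (prodToTensor_single_mk _ _).symm
  congr 2
  · exact (mk_face_two_chain (proj r.1) (desc r)).symm

-- The pullback is thin with at most one class, and it is inhabited exactly when `f` is isomorphic
-- to an identity map.
open scoped Classical in
theorem incidenceCounit_single_cls {A C : FinSurj} (f : A ⟶ C) :
    incidenceCounit (fatNerve FinSurj) (Finsupp.single (cls f) 1) =
      if Function.Injective f.1 then 1 else 0 := by
  obtain ⟨h⟩ := PiZero.hom_of_mk_eq (cls f).mk_rep
  have := subsingleton_piZero_objCounit (cls f).rep
  rw [incidenceCounit, Finsupp.linearCombination_single, one_smul, homotopyCard_of_isThin]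
  split_ifs with hf
  · let σ : NS 0 := ⟨ComposableArrows.mk₀ A⟩
    let k : arr f ⟶ (degen (fatNerve FinSurj) (n := 0) 0).obj σ :=
      homMk₁ (x := arr f) (Equiv.refl A) (Equiv.ofBijective f.1 ⟨hf, f.2⟩).symm fun a =>
        (Equiv.ofBijective f.1 ⟨hf, f.2⟩).symm_apply_apply a
    have : Nonempty (PiZero (objCounit (fatNerve FinSurj) (nameOf (cls f).rep))) :=
      ⟨PiZero.mk ⟨⟨PUnit.unit⟩, σ, h ≫ k⟩⟩
    exact_mod_cast Nat.card_eq_one_iff_unique.2 ⟨inferInstance, inferInstance⟩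
  · have : IsEmpty (PiZero (objCounit (fatNerve FinSurj) (nameOf (cls f).rep))) := by
      refine ⟨fun c => hf ?_⟩
      obtain ⟨⟨⟨⟨⟩⟩, σ, φ⟩, rfl⟩ := PiZero.mk_surjective c
      let χ : arr f ⟶ (degen (fatNerve FinSurj) (n := 0) 0).obj σ := Groupoid.inv h ≫ φ
      intro a b hab
      apply (component χ 0).injective
      have key (a : A) : component χ 1 (f.1 a) = component χ 0 a :=
        (component_naturality χ (homOfLE (by decide : (0 : Fin 2) ≤ 1)) a).trans
          (congrFun (congrArg Subtype.val (σ.of.map_id 0)) (component χ 0 a))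
      exact (key a).symm.trans ((congrArg _ hab).trans (key b))
    simp

end FinSurj

/-! ### Classes of surjections as a free commutative monoid. -/

namespace FinSurj

theorem zero_eq_cls : (0 : PiZero (NS 1)) = cls (𝟙 empty) :=
  (mk_eq_cls (emptySimplex 1)).trans (cls_eq_cls (Equiv.refl _) (Equiv.refl _) fun _ => rfl)

/-- The disjoint union of two surjections. -/
def sumMap {A B A' B' : FinSurj} (f : A ⟶ B) (g : A' ⟶ B') :
    (⟨A ⊕ A'⟩ : FinSurj) ⟶ ⟨B ⊕ B'⟩ :=
  ⟨Sum.map f.1 g.1, f.2.sumMap g.2⟩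

theorem cls_add_cls {A B A' B' : FinSurj} (f : A ⟶ B) (g : A' ⟶ B') :
    cls f + cls g = cls (sumMap f g) :=
  (mk_eq_cls ((sumSimplices 1).obj (arr f, arr g))).trans
    (cls_eq_cls (Equiv.refl _) (Equiv.refl _) (by rintro (a | a) <;> rfl))

/-- Allows the two factors belonging to `r` to be computed with any convenient model of the quotient
in place of the quotient itself. -/
theorem cls_proj_desc {A B C : FinSurj} {f : A ⟶ C} (r : Below f) (g : A ⟶ B) (h : B ⟶ C)
    (hr : r.1 = Setoid.ker g.1) (hf : ∀ a, h.1 (g.1 a) = f.1 a) :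
    cls (proj r.1) = cls g ∧ cls (desc r) = cls h := by
  obtain ⟨r, hrf⟩ := r
  obtain rfl : r = Setoid.ker g.1 := hr
  let e : Quotient (Setoid.ker g.1) ≃ B := Setoid.quotientKerEquivOfSurjective g.1 g.2
  exact ⟨cls_eq_cls (Equiv.refl _) e fun _ => rfl,
    cls_eq_cls (f := desc ⟨_, hrf⟩) e (Equiv.refl _) (by rintro ⟨a⟩; exact (hf a).symm)⟩

/-- The number of elements of a fibre of a surjection. -/
noncomputable def fibreCard {A C : FinSurj} (f : A ⟶ C) (c : C) : ℕ+ :=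
  ⟨Nat.card {a // f.1 a = c}, by
    have : Nonempty {a // f.1 a = c} := (f.2 c).elim fun a h => ⟨⟨a, h⟩⟩
    exact Nat.card_pos⟩

/-- The class of the surjection from an `n`-element set to a point. -/
def ptCls (n : ℕ+) : PiZero (NS 1) := cls (SurjBialg.toPoint n)

theorem cls_eq_ptCls {A B : FinSurj} (f : A ⟶ B) (hB : Nat.card B = 1) (n : ℕ+)
    (hA : Nat.card A = n) : cls f = ptCls n :=
  cls_eq_cls (Finite.equivFinOfCardEq hA) (Finite.equivFinOfCardEq hB) fun _ =>
    Subsingleton.elim (α := Fin 1) _ _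

/-- The surjection with base `C` and given cardinalities of its fibres. -/
def sigmaFst (C : Type) [Finite C] (n : C → ℕ+) : (⟨Σ c, Fin (n c)⟩ : FinSurj) ⟶ ⟨C⟩ :=
  ⟨Sigma.fst, fun c => ⟨⟨c, ⟨0, (n c).pos⟩⟩, rfl⟩⟩

/-- Induction on the base: adding a point to `C` adds one fibre as a disjoint summand. -/
theorem cls_sigmaFst (C : Type) [Fintype C] (n : C → ℕ+) :
    cls (sigmaFst C n) = ∑ c, ptCls (n c) := by
  revert n
  refine Fintype.induction_empty_option (P := fun C _ => ∀ n : C → ℕ+,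
    cls (sigmaFst C n) = ∑ c, ptCls (n c)) ?_ ?_ ?_ C
  · intro α β _ e ih n
    let _ := Fintype.ofEquiv β e.symm
    rw [← e.sum_comp, ← ih fun c => n (e c)]
    exact (cls_eq_cls (f := sigmaFst α fun c => n (e c)) (g := sigmaFst β n)
      (Equiv.sigmaCongrLeft (β := fun c => Fin (n c)) e) e fun _ => rfl).symm
  · intro n
    rw [Fintype.sum_empty, zero_eq_cls]
    have : IsEmpty (⟨PEmpty⟩ : FinSurj) := inferInstanceAs (IsEmpty PEmpty)
    have : IsEmpty (⟨Σ c, Fin (n c)⟩ : FinSurj) :=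
      inferInstanceAs (IsEmpty (Σ c : PEmpty, Fin (n c)))
    have : IsEmpty empty := inferInstanceAs (IsEmpty Empty)
    exact cls_eq_cls (Equiv.equivOfIsEmpty _ _) (Equiv.equivOfIsEmpty _ _) fun a => isEmptyElim a
  · intro α _ ih n
    rw [Fintype.sum_option, ← ih, ptCls, cls_add_cls]
    let e : (Σ c, Fin (n c)) ≃ Fin (n none) ⊕ Σ c, Fin (n (some c)) :=
      { toFun := fun p => match p with
          | ⟨none, a⟩ => Sum.inl a
          | ⟨some c, a⟩ => Sum.inr ⟨c, a⟩
        invFun := Sum.elim (fun a => ⟨none, a⟩) fun p => ⟨some p.1, p.2⟩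
        left_inv := by rintro ⟨_ | c, a⟩ <;> rfl
        right_inv := by rintro (a | ⟨c, a⟩) <;> rfl }
    let e' : Option α ≃ Fin 1 ⊕ α :=
      { toFun := fun c => c.elim (Sum.inl 0) Sum.inr
        invFun := Sum.elim (fun _ => none) some
        left_inv := by rintro (_ | c) <;> rfl
        right_inv := by
          rintro (a | c)
          · exact congrArg Sum.inl (Subsingleton.elim _ _)
          · rfl }
    exact cls_eq_cls (f := sigmaFst (Option α) n) e e' (by rintro ⟨_ | c, a⟩ <;> rfl)

theorem cls_eq_sum {A C : FinSurj} [Fintype C] (f : A ⟶ C) :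
    cls f = ∑ c, ptCls (fibreCard f c) := by
  rw [← cls_sigmaFst]
  refine cls_eq_cls (g := sigmaFst C (fibreCard f)) ((Equiv.sigmaFiberEquiv f.1).symm.trans
    (Equiv.sigmaCongrRight fun c => Finite.equivFinOfCardEq rfl)) (Equiv.refl _) fun _ => rfl

theorem fibreCard_congr {A C A' C' : FinSurj} {f : A ⟶ C} {g : A' ⟶ C'} (c : C) (c' : C')
    (e : {a // f.1 a = c} ≃ {a // g.1 a = c'}) : fibreCard f c = fibreCard g c' :=
  PNat.coe_injective (Nat.card_congr e)

/-- The number of fibres of a given cardinality. -/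
noncomputable def fibreCount (n : ℕ+) : PiZero (NS 1) →+ ℕ where
  toFun := Quotient.lift (s := isIsomorphicSetoid (NS 1))
    (fun x => Nat.card {c // fibreCard (toMap x) c = n}) (by
      rintro x y ⟨h⟩
      refine Nat.card_congr ((component h.hom 1).subtypeEquiv fun c => ?_)
      rw [fibreCard_congr c (component h.hom 1 c) ((component h.hom 0).subtypeEquiv fun a => ?_)]
      rw [← (component h.hom 1).injective.eq_iff]
      exact Eq.congr_left (component_naturality h.hom _ a))
  map_zero' := by
    have : IsEmpty ((emptySimplex 1).of.obj 1) := inferInstanceAs (IsEmpty Empty)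
    exact Nat.card_of_isEmpty
  map_add' := by
    intro x y
    obtain ⟨A, C, f, rfl⟩ := exists_eq_cls x
    obtain ⟨A', C', g, rfl⟩ := exists_eq_cls y
    rw [cls_add_cls]
    change Nat.card {c : C ⊕ C' // fibreCard (sumMap f g) c = n} =
      Nat.card {c // fibreCard f c = n} + Nat.card {c // fibreCard g c = n}
    rw [← Nat.card_sum]
    refine Nat.card_congr (Equiv.subtypeSum.trans (Equiv.sumCongr
      (Equiv.subtypeEquivRight fun c => ?_) (Equiv.subtypeEquivRight fun c => ?_)))
    · rw [fibreCard_congr (f := f) (g := sumMap f g) c (Sum.inl c)]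
      exact
        { toFun := fun a => ⟨Sum.inl a.1, congrArg Sum.inl a.2⟩
          invFun := fun a => match a with
            | ⟨Sum.inl a, h⟩ => ⟨a, Sum.inl_injective h⟩
            | ⟨Sum.inr a, h⟩ => (Sum.inr_ne_inl h).elim
          left_inv := fun a => rfl
          right_inv := by
            rintro ⟨a | a, h⟩
            · rfl
            · exact (Sum.inr_ne_inl h).elim }
    · rw [fibreCard_congr (f := g) (g := sumMap f g) c (Sum.inr c)]
      exact
        { toFun := fun a => ⟨Sum.inr a.1, congrArg Sum.inr a.2⟩
          invFun := fun a => match a with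
            | ⟨Sum.inr a, h⟩ => ⟨a, Sum.inr_injective h⟩
            | ⟨Sum.inl a, h⟩ => (Sum.inl_ne_inr h).elim
          left_inv := fun a => rfl
          right_inv := by
            rintro ⟨a | a, h⟩
            · exact (Sum.inl_ne_inr h).elim
            · rfl }

theorem fibreCount_ptCls (n m : ℕ+) : fibreCount n (ptCls m) = if m = n then 1 else 0 := by
  change Nat.card {c : Fin 1 // fibreCard (SurjBialg.toPoint m) c = n} = _
  have h (c : Fin 1) : fibreCard (SurjBialg.toPoint m) c = m := by
    refine PNat.coe_injective ((Nat.card_congr (Equiv.subtypeUnivEquiv fun a => ?_)).trans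
      (Nat.card_fin m))
    exact Subsingleton.elim (α := Fin 1) _ _
  simp only [h]
  split_ifs with hmn <;> simp [hmn]

/-- The commutative monoid of classes of surjections is free on the classes of the surjections
to a point. -/
noncomputable def finsuppEquivPiZero : (ℕ+ →₀ ℕ) ≃+ PiZero (NS 1) :=
  AddEquiv.ofBijective (Finsupp.liftAddHom fun n => (multiplesHom _) (ptCls n)) (by
    constructor
    -- The number of fibres of size `n` is additive, so `fibreCount n` reads off the exponent of the
    -- generator `n`.
    · intro a b h
      ext n
      have key (a : ℕ+ →₀ ℕ) :
          fibreCount n (Finsupp.liftAddHom (fun n => (multiplesHom _) (ptCls n)) a) = a n := by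
        simpa [Finsupp.sum, map_sum, fibreCount_ptCls] using Eq.symm
      rw [← key a, h, key]
    · intro c
      obtain ⟨A, C, f, rfl⟩ := exists_eq_cls c
      have := Fintype.ofFinite C
      refine ⟨∑ c, Finsupp.single (fibreCard f c) 1, ?_⟩
      simp [cls_eq_sum f, map_sum])

theorem finsuppEquivPiZero_single (n : ℕ+) :
    finsuppEquivPiZero (Finsupp.single n 1) = ptCls n := by
  change Finsupp.liftAddHom (fun n => (multiplesHom _) (ptCls n)) (Finsupp.single n 1) = ptCls n
  simp

end FinSurj

/-! ### The bialgebra axioms for surjections. -/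

namespace SurjBialg

open FinSurj

/-- The basis vector of an isomorphism class of surjections. -/
noncomputable def ofClass (c : PiZero (NS 1)) : SurjBialg :=
  equivFinsupp.symm (Finsupp.single c 1)

theorem ofClass_zero : ofClass 0 = 1 := rfl

theorem ofClass_add (c d : PiZero (NS 1)) : ofClass (c + d) = ofClass c * ofClass d := by
  refine Eq.symm ((AddMonoidAlgebra.single_mul_single (R := ℚ) c d 1 1).trans ?_)
  rw [mul_one]
  rfl

theorem ofClass_sum {ι : Type*} (s : Finset ι) (c : ι → PiZero (NS 1)) :
    ofClass (∑ i ∈ s, c i) = ∏ i ∈ s, ofClass (c i) := by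
  classical
  induction s using Finset.induction_on with
  | empty => exact ofClass_zero
  | insert i s hi ih => rw [Finset.sum_insert hi, Finset.prod_insert hi, ofClass_add, ih]

theorem δ_eq_ofClass (n : ℕ+) : δ n = ofClass (ptCls n) := rfl

theorem induction_cls {P : SurjBialg → Prop}
    (cls : ∀ {A C : FinSurj} (f : A ⟶ C), P (ofClass (cls f)))
    (add : ∀ x y, P x → P y → P (x + y)) (smul : ∀ (r : ℚ) x, P x → P (r • x)) (x : SurjBialg) :
    P x := by
  obtain ⟨v, rfl⟩ := equivFinsupp.symm.surjective x
  induction v using Finsupp.induction_linear with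
  | zero => simpa using smul 0 _ (cls (𝟙 empty))
  | add v w hv hw => rw [map_add]; exact add _ _ hv hw
  | single c r =>
    obtain ⟨A, C, f, rfl⟩ := exists_eq_cls c
    have h := smul r _ (cls f)
    rwa [ofClass, ← map_smul, Finsupp.smul_single, smul_eq_mul, mul_one] at h

theorem linearMap_ext {M : Type*} [AddCommMonoid M] [Module ℚ M] {φ ψ : SurjBialg →ₗ[ℚ] M}
    (h : ∀ {A C : FinSurj} (f : A ⟶ C), φ (ofClass (cls f)) = ψ (ofClass (cls f))) : φ = ψ :=
  LinearMap.ext fun x => induction_cls (P := fun x => φ x = ψ x) h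
    (fun x y hx hy => by simp [hx, hy]) (fun r x hx => by simp [hx]) x

theorem comul_cls {A C : FinSurj} (f : A ⟶ C) :
    CoalgebraStruct.comul (R := ℚ) (ofClass (cls f)) =
      ∑ r : Below f, ofClass (cls (proj r.1)) ⊗ₜ[ℚ] ofClass (cls (desc r)) := by
  change TensorProduct.map _ _ (incidenceComul _ (equivFinsupp (equivFinsupp.symm _))) = _
  rw [LinearEquiv.apply_symm_apply, incidenceComul_single_cls, map_sum]
  rfl

open scoped Classical in
theorem counit_cls {A C : FinSurj} (f : A ⟶ C) :
    CoalgebraStruct.counit (R := ℚ) (ofClass (cls f)) = if Function.Injective f.1 then 1 else 0 := by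
  change incidenceCounit _ (equivFinsupp (equivFinsupp.symm _)) = _
  rw [LinearEquiv.apply_symm_apply, incidenceCounit_single_cls]

/-- Both relations live on the set `A`, so no transport along the first equality is needed. -/
theorem sigma_below_ext {A C : FinSurj} {f : A ⟶ C} {p q : Σ r : Below f, Below (proj r.1)}
    (h₁ : p.1.1 = q.1.1) (h₂ : p.2.1 = q.2.1) : p = q := by
  obtain ⟨⟨r, hr⟩, ⟨s, hs⟩⟩ := p
  obtain ⟨⟨r', hr'⟩, ⟨s', hs'⟩⟩ := q
  cases h₁
  cases h₂
  rfl

/-- A pair of composable factorizations determines a factorization of the first factor of the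
composite factorization. -/
def assocBelow {A C : FinSurj} (f : A ⟶ C) (p : Σ s : Below f, Below (desc s)) :
    Σ r : Below f, Below (proj r.1) :=
  ⟨⟨Setoid.ker (proj p.1.1 ≫ proj p.2.1).1, fun _ _ h =>
      p.2.2 ((proj_eq_iff p.2.1 _ _).1 h)⟩,
    ⟨p.1.1, fun _ _ h => Quotient.sound (congrArg (proj p.2.1).1 (Quotient.sound h))⟩⟩

/-- Relations on `A/s` correspond to relations on `A` containing `s`, so both sides parametrize
chains `s ≤ r ≤ ker f`. -/
theorem assocBelow_bijective {A C : FinSurj} (f : A ⟶ C) : Function.Bijective (assocBelow f) := by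
  constructor
  · rintro ⟨s, t⟩ ⟨s', t'⟩ h
    obtain rfl : s = s' := Below.ext (congrArg (fun q => q.2.1) h)
    have ht : Setoid.ker (proj s.1 ≫ proj t.1).1 = Setoid.ker (proj s.1 ≫ proj t'.1).1 :=
      congrArg (fun q => q.1.1) h
    suffices t = t' by rw [this]
    refine Below.ext (Setoid.ext ?_)
    rintro ⟨a⟩ ⟨b⟩
    have := Setoid.ext_iff.1 ht a b
    exact (proj_eq_iff t.1 _ _).symm.trans (this.trans (proj_eq_iff t'.1 _ _))
  · rintro ⟨r, s⟩
    have hsr (a b : A) (h : s.1 a b) : r.1 a b := (proj_eq_iff r.1 _ _).1 (s.2 h)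
    let s' : Below f := ⟨s.1, fun a b h => r.2 (hsr a b h)⟩
    let t : Below (desc s') := ⟨Setoid.ker (desc s).1, by
      rintro ⟨a⟩ ⟨b⟩ h
      exact r.2 ((proj_eq_iff r.1 a b).1 h)⟩
    refine ⟨⟨s', t⟩, sigma_below_ext (Setoid.ext fun a b => ?_) rfl⟩
    exact (proj_eq_iff t.1 _ _).trans (proj_eq_iff r.1 a b)

/-- Both sums run over factorizations of `f` into three surjections; under `assocBelow` the three
factors agree up to isomorphism. -/
theorem coassoc_cls {A C : FinSurj} (f : A ⟶ C) :
    ∑ r : Below f, ∑ s : Below (proj r.1), ofClass (cls (proj s.1)) ⊗ₜ[ℚ]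
      (ofClass (cls (desc s)) ⊗ₜ[ℚ] ofClass (cls (desc r))) =
    ∑ s : Below f, ∑ t : Below (desc s), ofClass (cls (proj s.1)) ⊗ₜ[ℚ]
      (ofClass (cls (proj t.1)) ⊗ₜ[ℚ] ofClass (cls (desc t))) := by
  rw [← Fintype.sum_sigma', ← Fintype.sum_sigma']
  refine (Fintype.sum_bijective _ (assocBelow_bijective f) _ _ ?_).symm
  rintro ⟨s, t⟩
  have h₁ := cls_proj_desc (assocBelow f ⟨s, t⟩).1 (proj s.1 ≫ proj t.1) (desc t) rfl
    fun _ => rfl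
  let e : Quotient (assocBelow f ⟨s, t⟩).1.1 ≃ Quotient t.1 :=
    Setoid.quotientKerEquivOfSurjective (proj s.1 ≫ proj t.1).1 (proj s.1 ≫ proj t.1).2
  have h₂ : cls (desc (assocBelow f ⟨s, t⟩).2) = cls (proj t.1) :=
    cls_eq_cls (Equiv.refl _) e (by rintro ⟨a⟩; rfl)
  dsimp only
  rw [h₁.2, h₂]
  rfl

/-- A relation below `f + g` never relates elements of different summands, since `f + g` keeps them
apart. It is therefore a pair of relations, and the quotients are disjoint unions. -/
theorem comul_cls_mul_cls {A C A' C' : FinSurj} (f : A ⟶ C) (g : A' ⟶ C') :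
    CoalgebraStruct.comul (R := ℚ) (ofClass (cls f) * ofClass (cls g)) =
      CoalgebraStruct.comul (ofClass (cls f)) * CoalgebraStruct.comul (ofClass (cls g)) := by
  rw [← ofClass_add, cls_add_cls, comul_cls, comul_cls, comul_cls, Finset.sum_mul_sum,
    ← Fintype.sum_prod_type']
  let φ (p : Below f × Below g) : Below (sumMap f g) :=
    ⟨Setoid.ker (sumMap (proj p.1.1) (proj p.2.1)).1, by
      rintro (a | a) (b | b) h
      · exact congrArg Sum.inl (p.1.2 ((proj_eq_iff _ _ _).1 (Sum.inl_injective h)))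
      · exact (Sum.inl_ne_inr h).elim
      · exact (Sum.inr_ne_inl h).elim
      · exact congrArg Sum.inr (p.2.2 ((proj_eq_iff _ _ _).1 (Sum.inr_injective h)))⟩
  have hl (p : Below f × Below g) (a b : A) : (φ p).1 (Sum.inl a) (Sum.inl b) ↔ p.1.1 a b :=
    Sum.inl_injective.eq_iff.trans (proj_eq_iff _ _ _)
  have hr (p : Below f × Below g) (a b : A') : (φ p).1 (Sum.inr a) (Sum.inr b) ↔ p.2.1 a b :=
    Sum.inr_injective.eq_iff.trans (proj_eq_iff _ _ _)
  have hφ : Function.Bijective φ := by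
    constructor
    · intro p q h
      refine Prod.ext (Below.ext (Setoid.ext fun a b => ?_))
        (Below.ext (Setoid.ext fun a b => ?_))
      · rw [← hl, h, hl]
      · rw [← hr, h, hr]
    · intro t
      refine ⟨(⟨t.1.comap Sum.inl, fun a b h => Sum.inl_injective (t.2 h)⟩,
        ⟨t.1.comap Sum.inr, fun a b h => Sum.inr_injective (t.2 h)⟩),
        Below.ext (Setoid.ext ?_)⟩
      rintro (a | a) (b | b)
      · exact hl _ a b
      · exact iff_of_false Sum.inl_ne_inr fun h => Sum.inl_ne_inr (t.2 h)
      · exact iff_of_false Sum.inr_ne_inl fun h => Sum.inr_ne_inl (t.2 h)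
      · exact hr _ a b
  refine (Fintype.sum_bijective φ hφ _ _ fun p => ?_).symm
  have h := cls_proj_desc (φ p) (sumMap (proj p.1.1) (proj p.2.1)) (sumMap (desc p.1) (desc p.2))
    rfl (by rintro (a | a) <;> rfl)
  rw [h.1, h.2, ← cls_add_cls, ← cls_add_cls, ofClass_add, ofClass_add,
    Algebra.TensorProduct.tmul_mul_tmul]

theorem counit_cls_mul_cls {A C A' C' : FinSurj} (f : A ⟶ C) (g : A' ⟶ C') :
    CoalgebraStruct.counit (R := ℚ) (ofClass (cls f) * ofClass (cls g)) =
      CoalgebraStruct.counit (R := ℚ) (ofClass (cls f)) *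
        CoalgebraStruct.counit (R := ℚ) (ofClass (cls g)) := by
  classical
  rw [← ofClass_add, cls_add_cls, counit_cls, counit_cls, counit_cls, ite_zero_mul_ite_zero, mul_one]
  exact if_congr Sum.map_injective rfl rfl

theorem isBialgebra : IsBialgebra ℚ SurjBialg where
  coassoc := by
    refine linearMap_ext fun f => ?_
    simp only [LinearMap.comp_apply, comul_cls, map_sum, LinearMap.rTensor_tmul,
      LinearMap.lTensor_tmul, LinearEquiv.coe_coe, TensorProduct.sum_tmul, TensorProduct.tmul_sum,
      TensorProduct.assoc_tmul]
    exact coassoc_cls f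
  counit_left := by
    classical
    refine linearMap_ext fun {A C} f => ?_
    simp only [LinearMap.comp_apply, comul_cls, map_sum, LinearMap.rTensor_tmul, counit_cls]
    -- The counit of the first factor vanishes unless the projection is injective, that is, unless
    -- the relation is equality.
    rw [Fintype.sum_eq_single (Below.mk ⊥ bot_le : Below f)]
    · have hinj : Function.Injective (proj (⊥ : Setoid A)).1 := fun a b h =>
        (proj_eq_iff ⊥ a b).1 h
      rw [if_pos hinj,
        (cls_proj_desc (f := f) (Below.mk ⊥ bot_le) (𝟙 A) f (by ext; rfl) fun _ => rfl).2]
      rfl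
    · intro r hr
      rw [if_neg, TensorProduct.zero_tmul]
      refine fun h => hr (Below.ext (eq_bot_iff.2 fun a b hab => ?_))
      exact h ((proj_eq_iff _ _ _).2 hab)
  counit_right := by
    classical
    refine linearMap_ext fun {A C} f => ?_
    simp only [LinearMap.comp_apply, comul_cls, map_sum, LinearMap.lTensor_tmul, counit_cls]
    -- The second factor is injective only when the relation is the whole kernel of `f`.
    rw [Fintype.sum_eq_single (Below.mk (Setoid.ker f.1) le_rfl : Below f)]
    · rw [if_pos]
      · rw [(cls_proj_desc (f := f) (Below.mk (Setoid.ker f.1) le_rfl) f (𝟙 C) rfl fun _ => rfl).1]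
        rfl
      · rintro ⟨a⟩ ⟨b⟩ h
        exact Quotient.sound h
    · intro r hr
      rw [if_neg, TensorProduct.tmul_zero]
      refine fun h => hr (Below.ext (le_antisymm r.2 fun a b hab => ?_))
      exact (proj_eq_iff _ _ _).1 (h (a₁ := (proj r.1).1 a) (a₂ := (proj r.1).1 b) hab)
  comul_one := by
    have hid : IsEmpty empty := inferInstanceAs (IsEmpty Empty)
    have hsub : Subsingleton (Below (𝟙 empty)) :=
      ⟨fun r s => Below.ext (Setoid.ext fun a => isEmptyElim a)⟩
    rw [← ofClass_zero, zero_eq_cls, comul_cls,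
      Fintype.sum_subsingleton _ (Below.mk (Setoid.ker (𝟙 empty : empty ⟶ empty).1) le_rfl)]
    have h := cls_proj_desc (f := 𝟙 empty)
      (Below.mk (Setoid.ker (𝟙 empty : empty ⟶ empty).1) le_rfl)
      (𝟙 empty) (𝟙 empty) rfl fun _ => rfl
    rw [h.1, h.2, ← zero_eq_cls]
    rfl
  comul_mul x y := by
    induction x using induction_cls with
    | cls f =>
      induction y using induction_cls with
      | cls g => exact comul_cls_mul_cls f g
      | add y z hy hz => rw [mul_add, map_add, hy, hz, map_add, mul_add]
      | smul r y hy => rw [mul_smul_comm, map_smul, hy, map_smul, mul_smul_comm]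
    | add x z hx hz => rw [add_mul, map_add, hx, hz, map_add, add_mul]
    | smul r x hx => rw [smul_mul_assoc, map_smul, hx, map_smul, smul_mul_assoc]
  counit_one := by
    classical
    rw [← ofClass_zero, zero_eq_cls, counit_cls]
    exact if_pos Function.injective_id
  counit_mul x y := by
    induction x using induction_cls with
    | cls f =>
      induction y using induction_cls with
      | cls g => exact counit_cls_mul_cls f g
      | add y z hy hz => rw [mul_add, map_add, hy, hz, map_add, mul_add]
      | smul r y hy => rw [mul_smul_comm, map_smul, hy, map_smul, mul_smul_comm]
    | add x z hx hz => rw [add_mul, map_add, hx, hz, map_add, add_mul]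
    | smul r x hx => rw [smul_mul_assoc, map_smul, hx, map_smul, smul_mul_assoc]

end SurjBialg

/-! ## Faà di Bruno's formula -/

section SetPartitions

variable {R S : Type*} [CommRing R] [CommRing S]

noncomputable instance {A : Type*} [Finite A] : Fintype (Setoid A) := Fintype.ofFinite _

/-- The weight of a map `A → B`: the weight `g` of its codomain times the weights `f` of its
fibres. -/
noncomputable def fibreWeight (g f : ℕ → R) {A B : Type*} (h : A → B) : R :=
  g (Nat.card B) * ∏ᶠ b, f (Nat.card {a // h a = b})

theorem fibreWeight_congr (g f : ℕ → R) {A B A' B' : Type*} {h : A → B} {k : A' → B'}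
    (e : A ≃ A') (e' : B ≃ B') (w : ∀ a, e' (h a) = k (e a)) :
    fibreWeight g f h = fibreWeight g f k := by
  rw [fibreWeight, fibreWeight, Nat.card_congr e', ← finprod_comp_equiv e']
  congr 1
  refine finprod_congr fun b => congrArg f (Nat.card_congr (e.subtypeEquiv fun a => ?_))
  rw [← w, e'.injective.eq_iff]

/-- The total weight of the set partitions of `A`. -/
noncomputable def bellSum (g f : ℕ → R) (A : Type*) [Finite A] : R :=
  ∑ r : Setoid A, fibreWeight g f (Quotient.mk r)

theorem bellSum_congr_equiv (g f : ℕ → R) {A B : Type*} [Finite A] [Finite B] (e : A ≃ B) :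
    bellSum g f A = bellSum g f B := by
  refine (Fintype.sum_bijective (Setoid.comap e) ?_ _ _ fun r => ?_).symm
  · refine Function.bijective_iff_has_inverse.2 ⟨Setoid.comap e.symm, fun r => ?_, fun r => ?_⟩ <;>
    · ext a b
      simp [Setoid.comap_rel]
  · exact (fibreWeight_congr g f e (Quotient.congr e fun a b => Iff.rfl) fun a => rfl).symm

theorem map_bellSum (φ : R →+* S) (g f : ℕ → R) (A : Type*) [Finite A] :
    φ (bellSum g f A) = bellSum (φ ∘ g) (φ ∘ f) A := by
  rw [bellSum, map_sum]
  refine Finset.sum_congr rfl fun r _ => ?_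
  rw [fibreWeight, map_mul]
  exact congrArg _ (φ.toMonoidHom.map_finprod (Set.toFinite _))

/-- A partition of a nonempty set has at least one block and all its blocks are nonempty, so the
weights at `0` never enter. This is what lets weights indexed by `ℕ` stand for variables indexed by
`ℕ+`. -/
theorem bellSum_congr_pos {g g' f f' : ℕ → R} {A : Type*} [Finite A] [Nonempty A]
    (hg : ∀ n, 0 < n → g n = g' n) (hf : ∀ n, 0 < n → f n = f' n) :
    bellSum g f A = bellSum g' f' A := by
  refine Finset.sum_congr rfl fun r _ => ?_
  have : Nonempty (Quotient r) := ‹Nonempty A›.map (Quotient.mk r)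
  rw [fibreWeight, fibreWeight, hg _ Nat.card_pos]
  refine congrArg _ (finprod_congr fun q => hf _ ?_)
  have : Nonempty {a // Quotient.mk r a = q} := nonempty_subtype.2 (Quotient.exists_rep q)
  exact Nat.card_pos

theorem bellSum_of_isEmpty (g f : ℕ → R) (A : Type*) [Finite A] [IsEmpty A] :
    bellSum g f A = g 0 := by
  have : Subsingleton (Setoid A) := ⟨fun r s => Setoid.ext fun a => isEmptyElim a⟩
  have hq : IsEmpty (Quotient (⊥ : Setoid A)) := ⟨fun q => isEmptyElim q.out⟩
  rw [bellSum, Fintype.sum_subsingleton _ (⊥ : Setoid A), fibreWeight, finprod_of_isEmpty, mul_one,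
    Nat.card_of_isEmpty]

open scoped Classical in
/-- The map on `Option A` with one fibre `insert none S`, and the classes of `r` as its other
fibres. -/
noncomputable def optionMap {A : Type*} (S : Finset A) (r : Setoid {a // a ∉ S}) :
    Option A → Option (Quotient r)
  | none => none
  | some a => if h : a ∈ S then none else some (Quotient.mk r ⟨a, h⟩)

section OptionMap

variable {A : Type*} (S : Finset A) (r : Setoid {a // a ∉ S})

theorem optionMap_some_eq_none (a : A) : optionMap S r (some a) = none ↔ a ∈ S := by
  by_cases h : a ∈ S <;> simp [optionMap, h]

theorem optionMap_some_of_notMem (a : {a // a ∉ S}) :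
    optionMap S r (some a) = some (Quotient.mk r a) := by
  simp [optionMap, a.2]

theorem optionMap_surjective : Function.Surjective (optionMap S r) := by
  rintro (_ | q)
  · exact ⟨none, rfl⟩
  · obtain ⟨a, rfl⟩ := Quotient.exists_rep q
    exact ⟨some a, optionMap_some_of_notMem S r a⟩

theorem card_fibre_optionMap_none [Finite A] :
    Nat.card {a // optionMap S r a = none} = S.card + 1 := by
  have e : {a // optionMap S r a = none} ≃ Option S :=
    { toFun := fun a => match a with
        | ⟨none, _⟩ => none
        | ⟨some a, h⟩ => some ⟨a, (optionMap_some_eq_none S r a).1 h⟩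
      invFun := fun a => match a with
        | none => ⟨none, rfl⟩
        | some a => ⟨some a, (optionMap_some_eq_none S r a).2 a.2⟩
      left_inv := by rintro ⟨_ | a, h⟩ <;> rfl
      right_inv := by rintro (_ | a) <;> rfl }
  rw [Nat.card_congr e, Finite.card_option, Nat.card_eq_fintype_card, Fintype.card_coe]

theorem card_fibre_optionMap_some (q : Quotient r) :
    Nat.card {a // optionMap S r a = some q} = Nat.card {a // Quotient.mk r a = q} := by
  symm
  refine Nat.card_eq_of_bijective (fun a => ⟨some a.1, by rw [optionMap_some_of_notMem, a.2]⟩)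
    ⟨fun a b h => ?_, ?_⟩
  · exact Subtype.ext (Subtype.ext (Option.some_injective _ (congrArg Subtype.val h)))
  · rintro ⟨_ | a, h⟩
    · exact absurd h (by simp [optionMap])
    · have ha : a ∉ S := fun ha => by simp [(optionMap_some_eq_none S r a).2 ha] at h
      refine ⟨⟨⟨a, ha⟩, ?_⟩, rfl⟩
      rw [optionMap_some_of_notMem S r ⟨a, ha⟩] at h
      exact Option.some_injective _ h

theorem fibreWeight_optionMap [Finite A] {R : Type*} [CommRing R] (g f : ℕ → R) :
    fibreWeight g f (optionMap S r) =
      f (S.card + 1) * fibreWeight (fun n => g (n + 1)) f (Quotient.mk r) := by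
  have := Fintype.ofFinite (Quotient r)
  rw [fibreWeight, fibreWeight, finprod_eq_prod_of_fintype, finprod_eq_prod_of_fintype,
    Fintype.prod_option, card_fibre_optionMap_none, Finite.card_option]
  simp only [card_fibre_optionMap_some]
  ring

end OptionMap

/-- A partition of `Option A` amounts to the block of `none`, with `none` removed, together with a
partition of the remaining elements. -/
theorem bijective_ker_optionMap (A : Type*) [Fintype A] :
    Function.Bijective fun p : Σ S : Finset A, Setoid {a // a ∉ S} =>
      Setoid.ker (optionMap p.1 p.2) := by
  classical
  have hnone (S : Finset A) (r : Setoid {a // a ∉ S}) (a : A) :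
      Setoid.ker (optionMap S r) none (some a) ↔ a ∈ S :=
    eq_comm.trans (optionMap_some_eq_none S r a)
  have hsome (S : Finset A) (r : Setoid {a // a ∉ S}) (a b : {a // a ∉ S}) :
      Setoid.ker (optionMap S r) (some a) (some b) ↔ r a b := by
    rw [Setoid.ker_def, optionMap_some_of_notMem, optionMap_some_of_notMem,
      (Option.some_injective _).eq_iff]
    exact Quotient.eq
  constructor
  · rintro ⟨S, r⟩ ⟨T, s⟩ h
    have h' : Setoid.ker (optionMap S r) = Setoid.ker (optionMap T s) := h
    obtain rfl : S = T := by
      ext a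
      rw [← hnone S r, h', hnone]
    obtain rfl : r = s := by
      ext a b
      rw [← hsome S r, h', hsome]
    rfl
  · intro t
    let S : Finset A := {a | t none (some a)}
    let r : Setoid {a // a ∉ S} := t.comap fun a => some a.1
    have hS (a : A) : a ∈ S ↔ t none (some a) := by simp [S]
    have h₁ (a : A) : Setoid.ker (optionMap S r) none (some a) ↔ t none (some a) :=
      (hnone S r a).trans (hS a)
    refine ⟨⟨S, r⟩, Setoid.ext ?_⟩
    rintro (_ | a) (_ | b)
    · exact iff_of_true rfl (t.refl' _)
    · exact h₁ b
    · exact (Setoid.comm' _).trans ((h₁ a).trans (Setoid.comm' t))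
    · by_cases ha : t none (some a)
      · have ha' := (h₁ a).2 ha
        refine ⟨fun h => t.trans' (t.symm' ha) ((h₁ b).1 (Setoid.trans' _ ha' h)),
          fun h => Setoid.trans' _ (Setoid.symm' _ ha') ((h₁ b).2 (t.trans' ha h))⟩
      · by_cases hb : t none (some b)
        · have hb' := (h₁ b).2 hb
          refine ⟨fun h => absurd ((h₁ a).1 (Setoid.trans' _ hb' (Setoid.symm' _ h))) ha,
            fun h => absurd (t.trans' hb (t.symm' h)) ha⟩
        · exact hsome S r ⟨a, (hS a).not.2 ha⟩ ⟨b, (hS b).not.2 hb⟩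

/-- Sorting partitions by the block of `none`, of size `S.card + 1`, gives a recursion. The shift in
`g` accounts for that extra block. -/
theorem bellSum_option (g f : ℕ → R) (A : Type*) [Fintype A] :
    bellSum g f (Option A) = ∑ S : Finset A,
      f (S.card + 1) * bellSum (fun n => g (n + 1)) f {a // a ∉ S} := by
  simp only [bellSum, Finset.mul_sum]
  rw [← Fintype.sum_sigma']
  refine (Fintype.sum_bijective _ (bijective_ker_optionMap A) _ _ fun p => ?_).symm
  rw [← fibreWeight_optionMap]
  exact (fibreWeight_congr g f (h := Quotient.mk (Setoid.ker (optionMap p.1 p.2))) (Equiv.refl _)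
    (Setoid.quotientKerEquivOfSurjective _ (optionMap_surjective p.1 p.2)) fun _ => rfl).symm

end SetPartitions

/-! ### Taylor coefficients of composites and the comultiplication dual to substitution. -/

namespace FaaDiBruno

variable {R : Type*} [CommRing R]

theorem derivAtZero_eq (n : ℕ) (F : PowerSeries R) :
    derivAtZero n F = n.factorial * PowerSeries.coeff n F :=
  PowerSeries.constantCoeff_iterate_derivative F n

theorem derivAtZero_succ (n : ℕ) (F : PowerSeries R) :
    derivAtZero (n + 1) F = derivAtZero n (PowerSeries.derivative R F) := by
  rw [derivAtZero, Function.iterate_succ_apply, derivAtZero]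

/-- The Leibniz rule, with each binomial coefficient spread out as a sum over subsets so that it
matches `bellSum_option` term by term. -/
theorem derivAtZero_mul (A : Type*) [Fintype A] (F G : PowerSeries R) :
    derivAtZero (Fintype.card A) (F * G) =
      ∑ S : Finset A, derivAtZero S.card F * derivAtZero (Fintype.card A - S.card) G := by
  rw [← Finset.powerset_univ, Finset.sum_powerset_apply_card
    (fun m => derivAtZero m F * derivAtZero (Fintype.card A - m) G), Finset.card_univ,
    derivAtZero_eq, PowerSeries.coeff_mul, Finset.Nat.sum_antidiagonal_eq_sum_range_succ_mk,
    Finset.mul_sum]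
  refine Finset.sum_congr rfl fun m hm => ?_
  have h := Nat.choose_mul_factorial_mul_factorial (Nat.lt_succ_iff.1 (Finset.mem_range.1 hm))
  rw [← h, derivAtZero_eq, derivAtZero_eq, nsmul_eq_mul]
  push_cast
  ring

/-- Faà di Bruno's formula: the Taylor coefficients of a composite power series. -/
theorem derivAtZero_subst {F : PowerSeries R} (hF : PowerSeries.constantCoeff F = 0)
    (G : PowerSeries R) (A : Type) [Fintype A] :
    derivAtZero (Fintype.card A) (G.subst F) =
      bellSum (fun n => derivAtZero n G) (fun n => derivAtZero n F) A := by
  have hs := PowerSeries.HasSubst.of_constantCoeff_zero' hF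
  -- `G` must vary, since the chain rule replaces it by its derivative.
  induction hn : Fintype.card A using Nat.strong_induction_on generalizing A G with
  | _ n ih =>
  cases n with
  | zero =>
    have := Fintype.card_eq_zero_iff.1 hn
    rw [bellSum_of_isEmpty]
    change PowerSeries.constantCoeff (G.subst F) = PowerSeries.constantCoeff G
    rw [← PowerSeries.coeff_zero_eq_constantCoeff_apply, PowerSeries.coeff_subst' hs,
      finsum_eq_single _ 0]
    · simp
    · intro d hd
      rw [PowerSeries.coeff_zero_eq_constantCoeff_apply, map_pow, hF, zero_pow hd, smul_zero]
  | succ n =>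
    let e : A ≃ Option (Fin n) := Fintype.equivOfCardEq (by simp [hn])
    -- Differentiating once turns `G ∘ F` into `F' · (G' ∘ F)`; the Leibniz rule then reproduces the
    -- recursion over the block of the distinguished element.
    rw [bellSum_congr_equiv _ _ e, bellSum_option, derivAtZero_succ,
      PowerSeries.derivative_subst hs, mul_comm]
    have h := derivAtZero_mul (Fin n) (PowerSeries.derivative R F)
      ((PowerSeries.derivative R G).subst F)
    rw [Fintype.card_fin] at h
    rw [h]
    refine Finset.sum_congr rfl fun S _ => ?_
    have hc : Fintype.card {a // a ∉ S} = n - S.card := by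
      rw [Fintype.card_subtype_compl, Fintype.card_fin, Fintype.card_coe]
    rw [derivAtZero_succ, ih (n - S.card) (by omega) _ _ hc]
    simp only [derivAtZero_succ]

variable [Algebra ℚ R]

theorem constantCoeff_expSeries (a : ℕ+ → R) :
    PowerSeries.constantCoeff (expSeries a) = 0 := by
  rw [← PowerSeries.coeff_zero_eq_constantCoeff_apply, expSeries, PowerSeries.coeff_mk,
    dif_neg (lt_irrefl 0)]

theorem derivAtZero_expSeries (a : ℕ+ → R) (n : ℕ+) : derivAtZero n (expSeries a) = a n := by
  rw [derivAtZero_eq, expSeries, PowerSeries.coeff_mk, dif_pos n.pos, ← mul_assoc,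
    ← map_natCast (algebraMap ℚ R), ← map_mul, mul_one_div_cancel, map_one, one_mul]
  · rfl
  · exact_mod_cast (Nat.factorial_pos _).ne'

theorem evalAt_A (F : PowerSeries ℚ) (n : ℕ+) : evalAt F (A n) = derivAtZero n F :=
  MvPolynomial.aeval_X _ _

theorem evalAt₂_left (F G : PowerSeries ℚ) (n : ℕ+) :
    evalAt₂ F G (A n ⊗ₜ 1) = derivAtZero n F := by
  rw [evalAt₂, Algebra.TensorProduct.lift_tmul, evalAt_A, map_one, mul_one]

theorem evalAt₂_right (F G : PowerSeries ℚ) (n : ℕ+) :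
    evalAt₂ F G (1 ⊗ₜ A n) = derivAtZero n G := by
  rw [evalAt₂, Algebra.TensorProduct.lift_tmul, evalAt_A, map_one, one_mul]

/-- Faà di Bruno's formula for the universal pair of series, pushed along an arbitrary `φ`. It
serves both for evaluation at two power series and for the comparison with surjections. -/
theorem map_comulAlgHom_A {S : Type*} [CommRing S]
    (φ : FaaDiBruno ⊗[ℚ] FaaDiBruno →+* S) (n : ℕ+) {g f : ℕ → S}
    (hg : ∀ k : ℕ+, φ (1 ⊗ₜ A k) = g k) (hf : ∀ k : ℕ+, φ (A k ⊗ₜ 1) = f k) :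
    φ (comulAlgHom (A n)) = bellSum g f (Fin n) := by
  have h := derivAtZero_subst
    (constantCoeff_expSeries fun k => A k ⊗ₜ[ℚ] (1 : FaaDiBruno))
    (expSeries fun k => (1 : FaaDiBruno) ⊗ₜ[ℚ] A k) (Fin n)
  rw [Fintype.card_fin] at h
  have hn : Nonempty (Fin n) := ⟨⟨0, n.pos⟩⟩
  rw [comulAlgHom, A, MvPolynomial.aeval_X, h, map_bellSum]
  refine bellSum_congr_pos (fun k hk => ?_) (fun k hk => ?_)
  · exact (congrArg φ (derivAtZero_expSeries _ ⟨k, hk⟩)).trans (hg ⟨k, hk⟩)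
  · exact (congrArg φ (derivAtZero_expSeries _ ⟨k, hk⟩)).trans (hf ⟨k, hk⟩)

theorem isDualToSubstitution_comulAlgHom : IsDualToSubstitution comulAlgHom := by
  intro n F G hF
  have h := derivAtZero_subst hF G (Fin n)
  rw [Fintype.card_fin] at h
  rw [h]
  exact map_comulAlgHom_A (evalAt₂ F G).toRingHom n (evalAt₂_right F G) (evalAt₂_left F G)

/-- Polynomials in two families of variables, as elements of the tensor square. -/
noncomputable def ofTwoFamilies : MvPolynomial (ℕ+ ⊕ ℕ+) ℚ →ₐ[ℚ] FaaDiBruno ⊗[ℚ] FaaDiBruno :=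
  MvPolynomial.aeval (Sum.elim (fun n => A n ⊗ₜ 1) fun n => 1 ⊗ₜ A n)

theorem ofTwoFamilies_surjective : Function.Surjective ofTwoFamilies := by
  intro x
  induction x using TensorProduct.induction_on with
  | zero => exact ⟨0, map_zero _⟩
  | add x y hx hy =>
    obtain ⟨p, rfl⟩ := hx
    obtain ⟨q, rfl⟩ := hy
    exact ⟨p + q, map_add _ _ _⟩
  | tmul p q =>
    refine ⟨MvPolynomial.rename Sum.inl p * MvPolynomial.rename Sum.inr q, ?_⟩
    have hl : ofTwoFamilies.comp (MvPolynomial.rename Sum.inl) =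
        Algebra.TensorProduct.includeLeft :=
      MvPolynomial.algHom_ext fun n => by simp [ofTwoFamilies, A]
    have hr : ofTwoFamilies.comp (MvPolynomial.rename Sum.inr) =
        Algebra.TensorProduct.includeRight :=
      MvPolynomial.algHom_ext fun n => by simp [ofTwoFamilies, A]
    have hl' := DFunLike.congr_fun hl p
    have hr' := DFunLike.congr_fun hr q
    simp only [AlgHom.comp_apply, Algebra.TensorProduct.includeLeft_apply,
      Algebra.TensorProduct.includeRight_apply] at hl' hr'
    rw [map_mul, hl', hr', Algebra.TensorProduct.tmul_mul_tmul, one_mul, mul_one]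

/-- Any two rational sequences are the higher Taylor coefficients of some `F` and `G` without
constant term, so evaluations realize all rational points, and a polynomial over the infinite field
`ℚ` is determined by its values there. -/
theorem ext_evalAt₂ {x y : FaaDiBruno ⊗[ℚ] FaaDiBruno}
    (h : ∀ F G : PowerSeries ℚ, PowerSeries.constantCoeff F = 0 →
      evalAt₂ F G x = evalAt₂ F G y) : x = y := by
  obtain ⟨p, rfl⟩ := ofTwoFamilies_surjective x
  obtain ⟨q, rfl⟩ := ofTwoFamilies_surjective y
  refine congrArg _ (MvPolynomial.funext fun a => ?_)
  let F := expSeries fun n => a (Sum.inl n)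
  let G := expSeries fun n => a (Sum.inr n)
  have key : (evalAt₂ F G).comp ofTwoFamilies = MvPolynomial.aeval a := by
    refine MvPolynomial.algHom_ext ?_
    rintro (n | n)
    · simp [ofTwoFamilies, evalAt₂_left, F, derivAtZero_expSeries]
    · simp [ofTwoFamilies, evalAt₂_right, G, derivAtZero_expSeries]
  have := h F G (constantCoeff_expSeries _)
  rwa [← AlgHom.comp_apply, ← AlgHom.comp_apply, key] at this

theorem isDualToSubstitution_iff (Δ : FaaDiBruno →ₐ[ℚ] FaaDiBruno ⊗[ℚ] FaaDiBruno) :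
    IsDualToSubstitution Δ ↔
      Δ.toLinearMap = CoalgebraStruct.comul (R := ℚ) (A := FaaDiBruno) := by
  constructor
  · intro h
    refine congrArg AlgHom.toLinearMap (a₂ := comulAlgHom) (MvPolynomial.algHom_ext fun n => ?_)
    exact ext_evalAt₂ fun F G hF =>
      (h n F G hF).trans (isDualToSubstitution_comulAlgHom n F G hF).symm
  · intro h
    rw [AlgHom.toLinearMap_injective (h : Δ.toLinearMap = comulAlgHom.toLinearMap)]
    exact isDualToSubstitution_comulAlgHom

end FaaDiBruno

/-- The bialgebra axioms transport along an algebra isomorphism that is compatible with the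
comultiplications and the counits. -/
theorem IsBialgebra.of_algEquiv {R A B : Type*} [CommRing R] [Ring A] [Algebra R A]
    [CoalgebraStruct R A] [Ring B] [Algebra R B] [CoalgebraStruct R B] (hB : IsBialgebra R B)
    (e : A ≃ₐ[R] B)
    (hcounit : ∀ a, CoalgebraStruct.counit (R := R) (e a) = CoalgebraStruct.counit (R := R) a)
    (hcomul : ∀ a, CoalgebraStruct.comul (R := R) (e a) =
      Algebra.TensorProduct.map e.toAlgHom e.toAlgHom (CoalgebraStruct.comul (R := R) a)) :
    IsBialgebra R A := by
  let l : A ≃ₗ[R] B := e.toLinearEquiv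
  have hcounit' : CoalgebraStruct.counit (R := R) ∘ₗ l.toLinearMap =
      CoalgebraStruct.counit (R := R) := LinearMap.ext hcounit
  have hinj : Function.Injective (Algebra.TensorProduct.map e.toAlgHom e.toAlgHom) :=
    (Algebra.TensorProduct.congr e e).injective
  have hr (t : A ⊗[R] A) : (CoalgebraStruct.comul (R := R)).rTensor B
      (TensorProduct.map l.toLinearMap l.toLinearMap t) =
      TensorProduct.map (TensorProduct.map l.toLinearMap l.toLinearMap) l.toLinearMap
        ((CoalgebraStruct.comul (R := R)).rTensor A t) := by
    induction t using TensorProduct.induction_on with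
    | zero => simp
    | add x y hx hy => simp only [map_add, hx, hy]
    | tmul x y =>
      simp only [TensorProduct.map_tmul, LinearMap.rTensor_tmul]
      exact congrArg (· ⊗ₜ _) (hcomul x)
  have hl (t : A ⊗[R] A) : (CoalgebraStruct.comul (R := R)).lTensor B
      (TensorProduct.map l.toLinearMap l.toLinearMap t) =
      TensorProduct.map l.toLinearMap (TensorProduct.map l.toLinearMap l.toLinearMap)
        ((CoalgebraStruct.comul (R := R)).lTensor A t) := by
    induction t using TensorProduct.induction_on with
    | zero => simp
    | add x y hx hy => simp only [map_add, hx, hy]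
    | tmul x y =>
      simp only [TensorProduct.map_tmul, LinearMap.lTensor_tmul]
      exact congrArg (_ ⊗ₜ ·) (hcomul y)
  have ha (t : (A ⊗[R] A) ⊗[R] A) :
      TensorProduct.map l.toLinearMap (TensorProduct.map l.toLinearMap l.toLinearMap)
        (TensorProduct.assoc R A A A t) = TensorProduct.assoc R B B B
        (TensorProduct.map (TensorProduct.map l.toLinearMap l.toLinearMap) l.toLinearMap t) :=
    DFunLike.congr_fun (TensorProduct.map_map_comp_assoc_eq l.toLinearMap l.toLinearMap
      l.toLinearMap) t
  constructor
  -- Each axiom is checked after applying an injective tensor power of the isomorphism, where it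
  -- becomes the axiom of `B` at `e a`.
  · refine LinearMap.ext fun a => (TensorProduct.congr l (TensorProduct.congr l l)).injective ?_
    have h := DFunLike.congr_fun hB.coassoc (e a)
    simp only [LinearMap.comp_apply, hcomul] at h
    exact (ha _).trans ((congrArg _ (hr _).symm).trans (h.trans (hl _)))
  · refine LinearMap.ext fun a => (TensorProduct.congr (LinearEquiv.refl R R) l).injective ?_
    have h := DFunLike.congr_fun hB.counit_left (e a)
    simp only [LinearMap.comp_apply, hcomul] at h
    refine Eq.trans ?_ h
    change _ = LinearMap.rTensor _ _ (TensorProduct.map l.toLinearMap l.toLinearMap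
      (CoalgebraStruct.comul (R := R) a))
    rw [LinearMap.rTensor_map, hcounit']
    change TensorProduct.map _ _ (LinearMap.rTensor _ _ _) = _
    rw [LinearMap.map_rTensor]
    rfl
  · refine LinearMap.ext fun a => (TensorProduct.congr l (LinearEquiv.refl R R)).injective ?_
    have h := DFunLike.congr_fun hB.counit_right (e a)
    simp only [LinearMap.comp_apply, hcomul] at h
    refine Eq.trans ?_ h
    change _ = LinearMap.lTensor _ _ (TensorProduct.map l.toLinearMap l.toLinearMap
      (CoalgebraStruct.comul (R := R) a))
    rw [LinearMap.lTensor_map, hcounit']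
    change TensorProduct.map _ _ (LinearMap.lTensor _ _ _) = _
    rw [LinearMap.map_lTensor]
    rfl
  · apply hinj
    rw [← hcomul, map_one, hB.comul_one, map_one]
  · intro a b
    apply hinj
    rw [← hcomul, map_mul, hB.comul_mul, map_mul, hcomul, hcomul]
  · rw [← hcounit, map_one, hB.counit_one]
  · intro a b
    rw [← hcounit, map_mul, hB.counit_mul, hcounit, hcounit]

/-! ### The isomorphism between the two bialgebras. -/

namespace SurjBialg

open FinSurj FaaDiBruno

/-- The isomorphism of algebras `Aₙ ↦ δₙ`. -/
noncomputable def algEquiv : FaaDiBruno ≃ₐ[ℚ] SurjBialg :=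
  -- The polynomial ring is the monoid algebra of the exponent monoid `ℕ+ →₀ ℕ`, so an isomorphism
  -- of monoids suffices.
  AddMonoidAlgebra.domCongr ℚ ℚ finsuppEquivPiZero

theorem algEquiv_A (n : ℕ+) : algEquiv (A n) = δ n := by
  rw [δ_eq_ofClass, ← finsuppEquivPiZero_single]
  exact AddMonoidAlgebra.mapDomainRingEquiv_single finsuppEquivPiZero (1 : ℚ) _

/-- The counit as a homomorphism of algebras. -/
noncomputable def counitAlgHom : SurjBialg →ₐ[ℚ] ℚ :=
  AlgHom.ofLinearMap CoalgebraStruct.counit isBialgebra.counit_one isBialgebra.counit_mul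

/-- The comultiplication as a homomorphism of algebras. -/
noncomputable def comulAlgHom : SurjBialg →ₐ[ℚ] SurjBialg ⊗[ℚ] SurjBialg :=
  AlgHom.ofLinearMap CoalgebraStruct.comul isBialgebra.comul_one isBialgebra.comul_mul

/-- Both counits are multiplicative, so generators suffice: `n ↠ 1` is injective exactly for `n =
1`, which is also the only nonzero derivative of `x` at `0` of positive order. -/
theorem counit_algEquiv (p : FaaDiBruno) :
    CoalgebraStruct.counit (R := ℚ) (algEquiv p) = CoalgebraStruct.counit (R := ℚ) p := by
  classical
  suffices h : counitAlgHom.comp algEquiv.toAlgHom = evalAt PowerSeries.X from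
    DFunLike.congr_fun h p
  refine MvPolynomial.algHom_ext fun n => ?_
  change CoalgebraStruct.counit (R := ℚ) (algEquiv (A n)) = evalAt _ (A n)
  rw [algEquiv_A, evalAt_A, derivAtZero_eq, PowerSeries.coeff_X, δ_eq_ofClass, ptCls, counit_cls]
  by_cases hn : (n : ℕ) = 1
  · obtain rfl : n = 1 := PNat.coe_injective hn
    rw [if_pos, if_pos]
    · simp
    · rfl
    · exact fun a b _ => Subsingleton.elim (α := Fin 1) a b
  · rw [if_neg, if_neg hn, mul_zero]
    intro h
    have h₁ : (n : ℕ) ≤ 1 := by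
      simpa using Fintype.card_le_of_injective (β := Fin 1) _ h
    have := n.pos
    omega

/-- Every equivalence relation on `n` lies below the map to a point. Its second factor is `k ↠ 1`
with `k` the number of blocks, and its first factor is the disjoint union of the blocks mapping to
points, so it contributes exactly one weighted partition. -/
theorem comul_δ (n : ℕ+) {g f : ℕ → SurjBialg ⊗[ℚ] SurjBialg}
    (hg : ∀ k : ℕ+, 1 ⊗ₜ δ k = g k) (hf : ∀ k : ℕ+, δ k ⊗ₜ 1 = f k) :
    CoalgebraStruct.comul (R := ℚ) (δ n) = bellSum g f (Fin n) := by
  have hn : Nonempty (Fin n) := ⟨⟨0, n.pos⟩⟩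
  rw [δ_eq_ofClass, ptCls, comul_cls]
  refine Fintype.sum_bijective Below.rel ⟨fun r s => Below.ext, fun r =>
    ⟨⟨r, fun a b _ => Subsingleton.elim (α := Fin 1) _ _⟩, rfl⟩⟩ _ _ fun r => ?_
  have := Fintype.ofFinite (quot r.rel)
  have : Nonempty (quot r.rel) := hn.map (Quotient.mk _)
  let k : ℕ+ := ⟨Nat.card (quot r.rel), Nat.card_pos⟩
  have hk : cls (desc r) = ptCls k := cls_eq_ptCls _ (Nat.card_fin 1) k rfl
  have hprod : fibreWeight g f (Quotient.mk r.rel) =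
      g k * ∏ q : quot r.rel, f (fibreCard (proj r.rel) q) := by
    rw [← finprod_eq_prod_of_fintype]
    rfl
  rw [hprod, cls_eq_sum (proj r.rel), hk, ofClass_sum, ← hg]
  simp only [← hf]
  have h := map_prod (Algebra.TensorProduct.includeLeft : SurjBialg →ₐ[ℚ] SurjBialg ⊗[ℚ] SurjBialg)
    (fun q => δ (fibreCard (proj r.rel) q)) Finset.univ
  simp only [Algebra.TensorProduct.includeLeft_apply] at h
  rw [← h, Algebra.TensorProduct.tmul_mul_tmul, one_mul, mul_one]
  rfl

theorem comul_algEquiv (p : FaaDiBruno) :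
    CoalgebraStruct.comul (R := ℚ) (algEquiv p) =
      Algebra.TensorProduct.map algEquiv.toAlgHom algEquiv.toAlgHom
        (CoalgebraStruct.comul (R := ℚ) p) := by
  suffices h : comulAlgHom.comp algEquiv.toAlgHom =
      (Algebra.TensorProduct.map algEquiv.toAlgHom algEquiv.toAlgHom).comp
        FaaDiBruno.comulAlgHom from
    DFunLike.congr_fun h p
  refine MvPolynomial.algHom_ext fun n => ?_
  change CoalgebraStruct.comul (R := ℚ) (algEquiv (A n)) =
    (Algebra.TensorProduct.map algEquiv.toAlgHom algEquiv.toAlgHom).toRingHom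
      (FaaDiBruno.comulAlgHom (A n))
  -- The value `0` at `k = 0` is arbitrary: only positive sizes occur in partitions of a nonempty
  -- set.
  let g (k : ℕ) : SurjBialg ⊗[ℚ] SurjBialg := if h : 0 < k then 1 ⊗ₜ δ ⟨k, h⟩ else 0
  let f (k : ℕ) : SurjBialg ⊗[ℚ] SurjBialg := if h : 0 < k then δ ⟨k, h⟩ ⊗ₜ 1 else 0
  have hg (k : ℕ+) : 1 ⊗ₜ δ k = g k :=
    Eq.symm (show g k = 1 ⊗ₜ δ k from dif_pos k.pos)
  have hf (k : ℕ+) : δ k ⊗ₜ 1 = f k :=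
    Eq.symm (show f k = δ k ⊗ₜ 1 from dif_pos k.pos)
  rw [algEquiv_A, comul_δ n hg hf]
  refine (map_comulAlgHom_A _ n (fun k => ?_) fun k => ?_).symm
  · rw [← hg, ← algEquiv_A, ← map_one algEquiv]
    rfl
  · rw [← hf, ← algEquiv_A, ← map_one algEquiv]
    rfl

/-- The isomorphism of bialgebras `Aₙ ↦ δₙ`. -/
noncomputable def bialgEquiv : FaaDiBruno ≃ₐc[ℚ] SurjBialg where
  __ := algEquiv
  map_smul' := map_smul algEquiv
  counit_comp := LinearMap.ext counit_algEquiv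
  map_comp_comul := LinearMap.ext fun p => (comul_algEquiv p).symm

end SurjBialg

theorem mainTheorem1 :
    IsLocallyFiniteSimplicial (fatNerve FinSurj) ∧
    IsBialgebra ℚ SurjBialg ∧
    IsBialgebra ℚ FaaDiBruno ∧
    (∀ Δ : FaaDiBruno →ₐ[ℚ] FaaDiBruno ⊗[ℚ] FaaDiBruno,
      FaaDiBruno.IsDualToSubstitution Δ ↔
        Δ.toLinearMap = CoalgebraStruct.comul (R := ℚ) (A := FaaDiBruno)) ∧
    ∃ e : FaaDiBruno ≃ₐc[ℚ] SurjBialg, ∀ n : ℕ+, e (FaaDiBruno.A n) = SurjBialg.δ n :=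
  ⟨FinSurj.isLocallyFiniteSimplicial_fatNerve, SurjBialg.isBialgebra,
    -- The axioms for the Faà di Bruno bialgebra come from those for surjections, so associativity
    -- of substitution is never invoked.
    SurjBialg.isBialgebra.of_algEquiv SurjBialg.algEquiv SurjBialg.counit_algEquiv
      SurjBialg.comul_algEquiv,
    FaaDiBruno.isDualToSubstitution_iff, SurjBialg.bialgEquiv, SurjBialg.algEquiv_A⟩
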